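/- Let $q$ be a prime power and let $\mathcal C$ be an $[n,k]$ linear code over $\mathbb F_q$ with $1\le k<n$ and generator matrix $G$. An information set of $\mathcal C$ is a set $\mathcal I$ of $k$ coordinates such that the columns of $G$ indexed by $\mathcal I$ form an invertible matrix. Assume that $\mathcal C$ is MDS-PIR capacity-achieving: for some integers $\kappa$ and $\nu\ge1$ with $\kappa/\nu=k/n$ there is a binary $\nu\times n$ matrix each of whose columns has exactly $\kappa$ ones and the support of each of whose rows contains an information set of $\mathcal C$. Let $V$ be a $\mu\times f$ matrix over $\mathbb F_q$ with $\mu\ge 1$, without zero rows, and let $r=\operatorname{rank}(V)$. Messages $W^{(1)},\dots,W^{(f)}$ are $\beta\times k$ matrices ($\beta\ge1$) whose entries are all independent and uniform on $\mathbb F_q$; put $L=\beta k$. Each row of each message is encoded with $G$, and database $j\in\{1,\dots,n\}$ stores the $j$-th symbols $C_j$ of all the resulting codewords. The candidate evaluations are $X^{(v)}=\sum_{m=1}^f V_{v,m}W^{(m)}$ (entrywise), $v\in\{1,\dots,\mu\}$. A private linear computation (PLC) protocol consists of a choice of $\beta$ and, for every $v$, of queries $Q^{(v)}_1,\dots,Q^{(v)}_n$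 and answers $A^{(v)}_1,\dots,A^{(v)}_n$ (random variables with finite alphabets) such that 1. $(Q^{(v)}_1,\dots,Q^{(v)}_n)$ is independent of the messages; 2. $H(A^{(v)}_j\mid Q^{(v)}_j,C_j)=0$ for all $v,j$; 3. (privacy) $(Q^{(v)}_j,A^{(v)}_j,X^{(1)},\dots,X^{(\mu)})$ and $(Q^{(v')}_j,A^{(v')}_j,X^{(1)},\dots,X^{(\mu)})$ are identically distributed for all $v\ne v'$ and all $j$; 4. (recovery) $H(X^{(v)}\mid A^{(v)}_1,\dots,A^{(v)}_n,Q^{(v)}_1,\dots,Q^{(v)}_n)=0$ for all $v$. Its rate is $L\,\mathrm H_{\min}/D$, where $\mathrm H_{\min}$ is the minimum over $v$ of the entropy, in $q$-ary units, of one symbol of $X^{(v)}$, and $D$ is the total download cost, $D=\sum_{j=1}^n H(A^{(v)}_j)$ in $q$-ary units (which by privacy does not depend on $v$). Then the PLC capacity, that is, the maximum of the rates of all PLC protocols for the given $G$ and $V$, exists and equals $$\Bigl(1-\frac kn\Bigr)\Bigl[1-\Bigl(\frac kn\Bigr)^{r}\Bigr]^{-1}.$$ The same holds if the download cost is instead measured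 as the number of downloaded $q$-ary symbols, $D=\sum_{j=1}^n\log_q|\mathcal A_j|$, where $\mathcal A_j$ is the alphabet of the answers of database $j$. -/

import Mathlib

open MeasureTheory

namespace PrivateComputation

/-! ### Entropy of random variables with finite alphabets -/

section Entropy

variable {Ω : Type*} [MeasurableSpace Ω]

/-- The Shannon entropy `H(Z)`, in `q`-ary units, of a random variable `Z` with values in a finite
alphabet `S`. -/
noncomputable def entropy (q : ℕ) (P : Measure Ω) {S : Type*} [Fintype S] (Z : Ω → S) : ℝ :=
  ∑ z : S, Real.negMulLog (P.real (Z ⁻¹' {z})) / Real.log q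

/-- The conditional entropy `H(Z | Y) = H(Z, Y) - H(Y)`. -/
noncomputable def condEntropy (q : ℕ) (P : Measure Ω) {S T : Type*} [Fintype S] [Fintype T]
    (Z : Ω → S) (Y : Ω → T) : ℝ :=
  entropy q P (fun ω => (Z ω, Y ω)) - entropy q P Y

/-- The mutual information `I(Z ; Y) = H(Z) + H(Y) - H(Z, Y)`. -/
noncomputable def mutualInfo (q : ℕ) (P : Measure Ω) {S T : Type*} [Fintype S] [Fintype T]
    (Z : Ω → S) (Y : Ω → T) : ℝ :=
  entropy q P Z + entropy q P Y - entropy q P (fun ω => (Z ω, Y ω))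

/-- `Z ∼ Z'`: two random variables with values in the same finite alphabet are identically
distributed. -/
def SameLaw (P : Measure Ω) {S : Type*} (Z Z' : Ω → S) : Prop :=
  ∀ z : S, P.real (Z ⁻¹' {z}) = P.real (Z' ⁻¹' {z})

/-- `Z` is a random variable with values in the (finite, discrete) alphabet `S`. -/
def IsRandomVariable {S : Type*} (Z : Ω → S) : Prop :=
  ∀ z : S, MeasurableSet (Z ⁻¹' {z})

end Entropy

/-! ### Linear codes that achieve the MDS-PIR capacity -/

section Codes

variable {F : Type*} [Field F] {k n ν : ℕ}

/-- `I` is an information set of the code with generator matrix `G`: it has `k` elements, and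
the `k × k` matrix formed by the columns of `G` with index in `I` is invertible. -/
def IsInformationSet (G : Matrix (Fin k) (Fin n) F) (I : Finset (Fin n)) : Prop :=
  ∃ e : Fin k ≃ {j : Fin n // j ∈ I}, IsUnit (G.submatrix id (fun i => (e i : Fin n)))

/-- The binary `ν × n` matrix `Λ` is a PIR achievable rate matrix (with parameters `κ, ν`) for the
code generated by `G`: each column has Hamming weight `κ`, and the support of each row contains an
information set. -/
def IsPIRAchievableRateMatrix (G : Matrix (Fin k) (Fin n) F) (κ : ℕ)
    (Λ : Matrix (Fin ν) (Fin n) Bool) : Prop :=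
  (∀ j : Fin n, (Finset.univ.filter (fun u : Fin ν => Λ u j = true)).card = κ) ∧
  (∀ u : Fin ν, ∃ I : Finset (Fin n),
    I ⊆ Finset.univ.filter (fun j : Fin n => Λ u j = true) ∧ IsInformationSet G I)

/-- The `[n, k]` code generated by `G` is MDS-PIR capacity-achieving: it has a PIR achievable rate
matrix with `κ / ν = k / n`. -/
def IsMDSPIRCapacityAchieving (G : Matrix (Fin k) (Fin n) F) : Prop :=
  ∃ (κ ν : ℕ) (Λ : Matrix (Fin ν) (Fin n) Bool),
    0 < ν ∧ (κ : ℚ) / ν = (k : ℚ) / n ∧ IsPIRAchievableRateMatrix G κ Λ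

end Codes

/-! ### The storage system and the candidate functions -/

section System

variable {F : Type*} [Field F] {k n f μ β : ℕ}

/-- `f` messages, each of which is a `β × k` matrix over `F`. -/
abbrev Messages (F : Type*) (f β k : ℕ) : Type _ := Fin f → Fin β → Fin k → F

/-- What the `j`-th database stores: the `j`-th code symbol of every row of every message, where a
row `x` is encoded as the codeword `x G`. -/
def stored (G : Matrix (Fin k) (Fin n) F) (w : Messages F f β k) (j : Fin n) :
    Fin f → Fin β → F :=
  fun m i => Matrix.vecMul (w m i) G j

/-- The evaluation of the `v`-th candidate function, which is the linear function given by the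
`v`-th row of `V`: each of its `β k` symbols is that function of the corresponding symbols of the
`f` messages. -/
def evaluation (V : Matrix (Fin μ) (Fin f) F) (w : Messages F f β k) (v : Fin μ) :
    Fin β × Fin k → F :=
  fun l => V.mulVec (fun m => w m l.1 l.2) v

end System

/-! ### Private linear computation protocols -/

/-- A protocol for the private computation of the linear functions given by the rows of `V`, of `f`
messages that are stored in `n` noncolluding databases with the code generated by `G`. -/
structure PLCProtocol {F : Type*} [Field F] [Fintype F] {k n f μ : ℕ}
    (G : Matrix (Fin k) (Fin n) F) (V : Matrix (Fin μ) (Fin f) F) where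
  /-- The number of rows of each message, so that a message has `L = β k` symbols. -/
  β : ℕ
  β_pos : 0 < β
  /-- The underlying probability space. -/
  Ω : Type
  measurableSpace : MeasurableSpace Ω
  P : Measure Ω
  isProbabilityMeasure : IsProbabilityMeasure P
  /-- The alphabet of the queries. -/
  Query : Type
  fintypeQuery : Fintype Query
  /-- The alphabet of the answers of each database. -/
  Answer : Fin n → Type
  fintypeAnswer : ∀ j, Fintype (Answer j)
  /-- The messages. -/
  W : Ω → Messages F f β k
  /-- The query `Q v j` sent to database `j` when the function with index `v` is desired. -/
  Q : Fin μ → ∀ _ : Fin n, Ω → Query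
  /-- The answer `A v j` of database `j` when the function with index `v` is desired. -/
  A : Fin μ → ∀ j : Fin n, Ω → Answer j
  isRandomVariable_W : IsRandomVariable W
  isRandomVariable_Q : ∀ v j, IsRandomVariable (Q v j)
  isRandomVariable_A : ∀ v j, IsRandomVariable (A v j)
  /-- The symbols of all messages are independent and uniformly distributed over `F`. -/
  uniform : ∀ w : Messages F f β k,
    P.real (W ⁻¹' {w}) = 1 / (Fintype.card (Messages F f β k) : ℝ)
  /-- The queries are generated without knowledge of the messages. -/
  independence : ∀ v,
    mutualInfo (Fintype.card F) P W (fun ω => fun j => Q v j ω) = 0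
  /-- An answer is a deterministic function of the query and of the data in the database. -/
  deterministic : ∀ v j,
    condEntropy (Fintype.card F) P (A v j) (fun ω => (Q v j ω, stored G (W ω) j)) = 0
  /-- Privacy: no database learns anything about the index of the desired function. -/
  privacy : ∀ v v' j, v ≠ v' →
    SameLaw P (fun ω => (Q v j ω, A v j ω, evaluation V (W ω)))
      (fun ω => (Q v' j ω, A v' j ω, evaluation V (W ω)))
  /-- Recovery: the answers and the queries determine the evaluation of the desired function. -/
  recovery : ∀ v,
    condEntropy (Fintype.card F) P (fun ω => evaluation V (W ω) v)
      (fun ω => ((fun j => A v j ω), (fun j => Q v j ω))) = 0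

namespace PLCProtocol

attribute [instance] measurableSpace isProbabilityMeasure fintypeQuery fintypeAnswer

variable {F : Type*} [Field F] [Fintype F] {k n f μ : ℕ}
  {G : Matrix (Fin k) (Fin n) F} {V : Matrix (Fin μ) (Fin f) F}

/-- `H_min`, the minimum over the candidate functions of the entropy of one symbol of the
evaluation (the symbols of one evaluation all have the same distribution). -/
noncomputable def minEntropy (p : PLCProtocol G V) : ℝ :=
  ⨅ x : Fin μ × (Fin p.β × Fin k),
    entropy (Fintype.card F) p.P (fun ω => evaluation V (p.W ω) x.1 x.2)

/-- The total download cost, measured as the sum of the entropies of the answers. By privacy it is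
the same for every index `v` of the desired function. -/
noncomputable def downloadEntropy (p : PLCProtocol G V) : ℝ :=
  ⨆ v : Fin μ, ∑ j : Fin n, entropy (Fintype.card F) p.P (p.A v j)

/-- The total download cost, measured as the number of `q`-ary symbols that are needed to send the
answers without compression. -/
noncomputable def downloadLength (p : PLCProtocol G V) : ℝ :=
  ∑ j : Fin n, Real.log (Fintype.card (p.Answer j)) / Real.log (Fintype.card F)

/-- The rate `L H_min / D`, with the download cost `D` measured by entropies. -/
noncomputable def rate (p : PLCProtocol G V) : ℝ :=
  ((p.β * k : ℕ) : ℝ) * p.minEntropy / p.downloadEntropy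

/-- The rate `L H_min / D`, with the download cost `D` measured by the number of symbols. -/
noncomputable def symbolRate (p : PLCProtocol G V) : ℝ :=
  ((p.β * k : ℕ) : ℝ) * p.minEntropy / p.downloadLength

end PLCProtocol

/-- `c` is the private linear computation capacity: the maximum of the rates of all protocols,
both when download costs are measured by the entropies of the answers and when they are measured
by the number of downloaded symbols. -/
def IsPLCCapacity {F : Type*} [Field F] [Fintype F] {k n f μ : ℕ}
    (G : Matrix (Fin k) (Fin n) F) (V : Matrix (Fin μ) (Fin f) F) (c : ℝ) : Prop :=
  IsGreatest (Set.range (fun p : PLCProtocol G V => p.rate)) c ∧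
  IsGreatest (Set.range (fun p : PLCProtocol G V => p.symbolRate)) c

end PrivateComputation

/-! Write `L = βk`, `r = rank V`, `ρ = κ/ν = k/n`, `δ = ν - κ`. Every candidate has a nonzero row,
so its symbols are uniform and `H_min = 1`. The claimed capacity is the inverse of `σ = 1 + ρ + ...
+ ρ^(r-1)`, so the theorem says that the least download is `Lσ`. Counting ones shows that each row
support of the rate matrix is itself an information set. This gives `ν` information sets `I u`, with
every database in exactly `κ` of them.

Converse. Choose `r` independent rows `B` of `V`. For `S ⊆ B` let `h(S)` be the sum over `j` of
`H(A_j | X_S, Q_j)`; by privacy it does not depend on the desired index. Take `v ∈ B \ S` as that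
index and put `S' = S ∪ {v}`. Then `h(S) ≥ H(A | X_S, Q) ≥ L + H(A | X_S', Q)` by recovery, since
`X_v` is uniform and independent of `X_S`. Given `X_S'` and `Q`, the contents of the databases in `I
u` are independent, so the last entropy is at least the part of `h(S')` that comes from `I u`.
Averaging over `u` yields `h(S) ≥ L + ρ h(S')`, hence `h(∅) ≥ Lσ` (`sum_fEntropy_answer_ge`). All
inequalities are instances of submodularity on a finite weighted set.

Achievability. Let `R` be the column space of `V`, of dimension `r`. A candidate is a linear form
`ε` on `R`, and with `ε e = 1` and `K = ker ε` one has `Λ^d R = Λ^d K ⊕ e ∧ Λ^(d-1) K`. A query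
component is `ω + e ∧ ω'`, where `ω` is a new symbol of degree `d` in `ΛK` and `ω'` is a symbol of
degree `d - 1` requested from other databases. A database with content `y` returns the wedge product
of `y` with the query. Writing `y = ε(y) e + y'`, the answer has `K`-part `y' ∧ ω` and `e`-part
`ε(y) ω - y' ∧ ω'`. The `K`-parts from an information set decode the interference `y' ∧ ω` at all
databases; this cancels `y' ∧ ω'`, and what remains decodes `ε(y) ω`. With `κ^(r-d) δ^d` symbols of
degree `d` per information set, the passage from symbols to the query of one database is an
isomorphism. A uniformly random automorphism of `F^β` in front of it makes each query a uniformly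
random isomorphism onto a space that does not involve `ε`, which is privacy. Binomial sums show that
the download is exactly `Lσ` symbols. -/

namespace PrivateComputation

/-! ### Shannon inequalities for functions on a finite weighted set -/

section FiniteEntropy

variable {τ : Type*} [Fintype τ] {S S' S'' : Type*}

open Classical in
/-- The total weight of the fibre of `f` through `t`. -/
noncomputable def fiberMass (p : τ → ℝ) (f : τ → S) (t : τ) : ℝ :=
  ∑ s, if f s = f t then p s else 0

/-- The Shannon entropy, in natural units, of the function `f` on the finite set `τ` with
weights `p`. -/
noncomputable def fEntropy (p : τ → ℝ) (f : τ → S) : ℝ :=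
  -∑ t, p t * Real.log (fiberMass p f t)

variable {p : τ → ℝ}

theorem fiberMass_nonneg (hp : ∀ t, 0 ≤ p t) (f : τ → S) (t : τ) : 0 ≤ fiberMass p f t :=
  Finset.sum_nonneg fun s _ => by split_ifs <;> simp [hp]

theorem le_fiberMass (hp : ∀ t, 0 ≤ p t) (f : τ → S) (t : τ) : p t ≤ fiberMass p f t := by
  classical
  have := Finset.single_le_sum (f := fun s => if f s = f t then p s else 0)
    (fun s _ => by split_ifs <;> simp [hp]) (Finset.mem_univ t)
  simpa [fiberMass] using this

theorem fiberMass_congr (f : τ → S) {t t' : τ} (h : f t = f t') :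
    fiberMass p f t = fiberMass p f t' := by
  unfold fiberMass; rw [h]

theorem fiberMass_anti (hp : ∀ t, 0 ≤ p t) {f : τ → S} {g : τ → S'}
    (h : ∀ t t', g t = g t' → f t = f t') (t : τ) : fiberMass p g t ≤ fiberMass p f t := by
  classical
  refine Finset.sum_le_sum fun s _ => ?_
  by_cases hg : g s = g t
  · simp [hg, h _ _ hg]
  · simp only [hg, if_false]; split_ifs <;> simp [hp]

/-- A function of `g` has at most the entropy of `g`. -/
theorem fEntropy_mono (hp : ∀ t, 0 ≤ p t) {f : τ → S} {g : τ → S'}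
    (h : ∀ t t', g t = g t' → f t = f t') : fEntropy p f ≤ fEntropy p g := by
  refine neg_le_neg (Finset.sum_le_sum fun t _ => ?_)
  rcases (hp t).eq_or_lt with h0 | h0
  · simp [← h0]
  · exact mul_le_mul_of_nonneg_left (Real.log_le_log (h0.trans_le (le_fiberMass hp g t))
      (fiberMass_anti hp h t)) h0.le

theorem fEntropy_congr (hp : ∀ t, 0 ≤ p t) {f : τ → S} {g : τ → S'}
    (h : ∀ t t', g t = g t' ↔ f t = f t') : fEntropy p f = fEntropy p g :=
  le_antisymm (fEntropy_mono hp fun t t' => (h t t').1) (fEntropy_mono hp fun t t' => (h t t').2)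

/-- This is the bound `E[p(x) p(y) / (p(x,y) p(m))] ≤ 1`. Expanding `p(x)` and `p(y)` as sums over
points `a`, `b` and summing over `t` first leaves at most `1 / p(m)` for each pair `a`, `b` with the
same value of `M`. -/
theorem sum_fiberMass_ratio_le (hp : ∀ t, 0 ≤ p t) {X : τ → S} {Y : τ → S'} {M : τ → S''}
    (hX : ∀ t t', X t = X t' → M t = M t') (hY : ∀ t t', Y t = Y t' → M t = M t') :
    ∑ t, p t * (fiberMass p X t * fiberMass p Y t /
      (fiberMass p (fun t => (X t, Y t)) t * fiberMass p M t)) ≤ ∑ t, p t := by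
  classical
  set J := fun t => (X t, Y t) with hJ
  have inner : ∀ a b, ∑ t, (if X a = X t then (if Y b = Y t then
      p t / (fiberMass p J t * fiberMass p M t) else 0) else 0) ≤
      if M b = M a then 1 / fiberMass p M a else 0 := by
    intro a b
    by_cases h : ∃ t, X a = X t ∧ Y b = Y t
    -- The `t` with `X t = X a` and `Y t = Y b` form a single fibre of `J`, the one through `c`; its
    -- weight cancels, or is zero and then contributes nothing.
    · obtain ⟨c, hca, hcb⟩ := h
      have hMa := hX _ _ hca
      have hMb := hY _ _ hcb
      rw [if_pos (hMb.trans hMa.symm)]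
      have : ∀ t, (if X a = X t then (if Y b = Y t then
          p t / (fiberMass p J t * fiberMass p M t) else 0) else 0) =
          (if J t = J c then p t else 0) / (fiberMass p J c * fiberMass p M a) := by
        intro t
        by_cases h1 : X a = X t
        · by_cases h2 : Y b = Y t
          · have hJt : J t = J c := by simp [hJ, ← h1, ← h2, ← hca, ← hcb]
            rw [if_pos h1, if_pos h2, if_pos hJt, fiberMass_congr J hJt,
              fiberMass_congr M (hX _ _ h1)]
          · have hJt : J t ≠ J c := fun h => h2 (hcb.trans (congrArg Prod.snd h).symm)
            rw [if_pos h1, if_neg h2, if_neg hJt, zero_div]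
        · have hJt : J t ≠ J c := fun h => h1 (hca.trans (congrArg Prod.fst h).symm)
          rw [if_neg h1, if_neg hJt, zero_div]
      rw [Finset.sum_congr rfl fun t _ => this t, ← Finset.sum_div]
      have hc : (∑ t, if J t = J c then p t else 0) = fiberMass p J c := by
        unfold fiberMass; congr!
      rw [hc, ← div_div]
      exact div_le_div_of_nonneg_right (div_self_le_one _) (fiberMass_nonneg hp M a)
    · rw [Finset.sum_eq_zero]
      · split_ifs
        · exact one_div_nonneg.2 (fiberMass_nonneg hp M a)
        · rfl
      · intro t _
        by_cases h1 : X a = X t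
        · rw [if_pos h1, if_neg fun h2 => h ⟨t, h1, h2⟩]
        · rw [if_neg h1]
  calc ∑ t, p t * (fiberMass p X t * fiberMass p Y t / (fiberMass p J t * fiberMass p M t))
      = ∑ t, ∑ a, ∑ b, p a * p b * (if X a = X t then (if Y b = Y t then
          p t / (fiberMass p J t * fiberMass p M t) else 0) else 0) := by
        refine Finset.sum_congr rfl fun t _ => ?_
        rw [mul_div_left_comm, ← mul_div_assoc, fiberMass, fiberMass, mul_div_assoc,
          Finset.sum_mul_sum, Finset.sum_mul]
        refine Finset.sum_congr rfl fun a _ => ?_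
        rw [Finset.sum_mul]
        refine Finset.sum_congr rfl fun b _ => ?_
        split_ifs <;> ring
    _ = ∑ a, ∑ b, p a * p b * ∑ t, (if X a = X t then (if Y b = Y t then
          p t / (fiberMass p J t * fiberMass p M t) else 0) else 0) := by
        rw [Finset.sum_comm]
        refine Finset.sum_congr rfl fun a _ => ?_
        rw [Finset.sum_comm]
        refine Finset.sum_congr rfl fun b _ => ?_
        rw [Finset.mul_sum]
    _ ≤ ∑ a, ∑ b, p a * p b * (if M b = M a then 1 / fiberMass p M a else 0) :=
        Finset.sum_le_sum fun a _ => Finset.sum_le_sum fun b _ =>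
          mul_le_mul_of_nonneg_left (inner a b) (mul_nonneg (hp a) (hp b))
    _ = ∑ a, p a * (fiberMass p M a / fiberMass p M a) := by
        refine Finset.sum_congr rfl fun a _ => ?_
        conv_rhs => rw [fiberMass, Finset.sum_div, Finset.mul_sum]
        refine Finset.sum_congr rfl fun b _ => ?_
        split_ifs
        · rw [fiberMass]; ring
        · simp
    _ ≤ ∑ a, p a := Finset.sum_le_sum fun a _ =>
        mul_le_of_le_one_right (hp a) (div_self_le_one _)

/-- Strong subadditivity of entropy: if `M` is a function of `X` and a function of `Y`, then
`H(X, Y) + H(M) ≤ H(X) + H(Y)`. -/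
theorem fEntropy_pair_add_le (hp : ∀ t, 0 ≤ p t) {X : τ → S} {Y : τ → S'} {M : τ → S''}
    (hX : ∀ t t', X t = X t' → M t = M t') (hY : ∀ t t', Y t = Y t' → M t = M t') :
    fEntropy p (fun t => (X t, Y t)) + fEntropy p M ≤ fEntropy p X + fEntropy p Y := by
  set J := fun t => (X t, Y t) with hJ
  have key : ∀ t, p t * Real.log (fiberMass p X t) + p t * Real.log (fiberMass p Y t) -
      p t * Real.log (fiberMass p J t) - p t * Real.log (fiberMass p M t) ≤
      p t * (fiberMass p X t * fiberMass p Y t / (fiberMass p J t * fiberMass p M t)) - p t := by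
    intro t
    rcases (hp t).eq_or_lt with h0 | h0
    · simp [← h0]
    have hX0 : 0 < fiberMass p X t := h0.trans_le (le_fiberMass hp X t)
    have hY0 : 0 < fiberMass p Y t := h0.trans_le (le_fiberMass hp Y t)
    have hJ0 : 0 < fiberMass p J t := h0.trans_le (le_fiberMass hp J t)
    have hM0 : 0 < fiberMass p M t := h0.trans_le (le_fiberMass hp M t)
    have h := Real.log_le_sub_one_of_pos (div_pos (mul_pos hX0 hY0) (mul_pos hJ0 hM0))
    rw [Real.log_div (mul_pos hX0 hY0).ne' (mul_pos hJ0 hM0).ne', Real.log_mul hX0.ne' hY0.ne',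
      Real.log_mul hJ0.ne' hM0.ne'] at h
    nlinarith [mul_le_mul_of_nonneg_left h h0.le]
  have hsum := Finset.sum_le_sum fun t (_ : t ∈ Finset.univ) => key t
  simp only [Finset.sum_sub_distrib, Finset.sum_add_distrib] at hsum
  have := sum_fiberMass_ratio_le hp hX hY
  simp only [fEntropy]
  linarith

/-- Submodularity: if `J` is a function of `(X, Y)` and `M` is a function of `X` and a function of
`Y`, then `H(J) + H(M) ≤ H(X) + H(Y)`. -/
theorem fEntropy_submodular {S₃ : Type*} (hp : ∀ t, 0 ≤ p t) {J : τ → S₃} {M : τ → S''} {X : τ → S}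
    {Y : τ → S'} (hJ : ∀ t t', X t = X t' → Y t = Y t' → J t = J t')
    (hX : ∀ t t', X t = X t' → M t = M t') (hY : ∀ t t', Y t = Y t' → M t = M t') :
    fEntropy p J + fEntropy p M ≤ fEntropy p X + fEntropy p Y := by
  have h1 : fEntropy p J ≤ fEntropy p (fun t => (X t, Y t)) :=
    fEntropy_mono hp fun t t' h => hJ t t' (congrArg Prod.fst h) (congrArg Prod.snd h)
  linarith [fEntropy_pair_add_le hp hX hY]

/-- The entropy of a function all of whose fibres have weight `1 / N`. -/
theorem fEntropy_of_fiberMass_eq {f : τ → S} {N : ℝ} (h1 : ∑ t, p t = 1)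
    (h : ∀ t, fiberMass p f t = 1 / N) : fEntropy p f = Real.log N := by
  simp only [fEntropy, h, ← Finset.sum_mul, h1, one_div, Real.log_inv]
  ring

theorem sum_negMulLog_fiber (f : τ → S) [Fintype S] [DecidableEq S] :
    ∑ z : S, Real.negMulLog (∑ t, if f t = z then p t else 0) = fEntropy p f := by
  simp only [Real.negMulLog, fEntropy]
  rw [← Finset.sum_neg_distrib]
  simp only [Finset.sum_mul, ← Finset.sum_neg_distrib, neg_mul]
  rw [Finset.sum_comm]
  refine Finset.sum_congr rfl fun t _ => ?_
  rw [Finset.sum_eq_single (f t)]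
  · rw [if_pos rfl, fiberMass]
    congr!
  · intro z _ hz
    rw [if_neg hz.symm]; simp
  · simp

end FiniteEntropy

/-! ### From random variables to functions on a finite weighted set -/

section Bridge

variable {Ω : Type*} [MeasurableSpace Ω] {P : Measure Ω} [IsProbabilityMeasure P]
  {τ S : Type*}

open Classical in
theorem measureReal_preimage_comp [Fintype τ] {T : Ω → τ} (hT : IsRandomVariable T) (f : τ → S) (s : S) :
    P.real ((fun ω => f (T ω)) ⁻¹' {s}) = ∑ t, if f t = s then P.real (T ⁻¹' {t}) else 0 := by
  have : (fun ω => f (T ω)) ⁻¹' {s} = ⋃ t ∈ Finset.univ.filter (fun t => f t = s), T ⁻¹' {t} := by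
    ext ω; simp
  rw [this, measureReal_biUnion_finset, Finset.sum_filter]
  · intro a _ b _ hab
    exact Disjoint.preimage _ (Set.disjoint_singleton.2 hab)
  · exact fun t _ => hT t

theorem IsRandomVariable.comp [Finite τ] {T : Ω → τ} (hT : IsRandomVariable T) (f : τ → S) :
    IsRandomVariable fun ω => f (T ω) := by
  intro s
  have : (fun ω => f (T ω)) ⁻¹' {s} = ⋃ t ∈ f ⁻¹' {s}, T ⁻¹' {t} := by
    ext ω; simp
  rw [this]
  exact MeasurableSet.biUnion (Set.toFinite _).countable fun t _ => hT t

theorem IsRandomVariable.prodMk {T : Ω → τ} {Z : Ω → S} (hT : IsRandomVariable T)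
    (hZ : IsRandomVariable Z) : IsRandomVariable (fun ω => (T ω, Z ω)) := by
  rintro ⟨t, z⟩
  have : (fun ω => (T ω, Z ω)) ⁻¹' {(t, z)} = T ⁻¹' {t} ∩ Z ⁻¹' {z} := by
    ext ω; simp
  rw [this]
  exact (hT t).inter (hZ z)

theorem IsRandomVariable.pi {ι : Type*} [Finite ι] {S : ι → Type*} {Z : ∀ i, Ω → S i}
    (hZ : ∀ i, IsRandomVariable (Z i)) : IsRandomVariable (fun ω i => Z i ω) := by
  intro z
  have : (fun ω i => Z i ω) ⁻¹' {z} = ⋂ i, Z i ⁻¹' {z i} := by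
    ext ω; simp [funext_iff]
  rw [this]
  exact MeasurableSet.iInter fun i => hZ i (z i)

theorem entropy_comp [Fintype τ] [Fintype S] {T : Ω → τ} (hT : IsRandomVariable T) (q : ℕ) (f : τ → S) :
    entropy q P (fun ω => f (T ω)) = fEntropy (fun t => P.real (T ⁻¹' {t})) f / Real.log q := by
  classical
  rw [entropy, ← Finset.sum_div, ← sum_negMulLog_fiber]
  congr 1
  refine Finset.sum_congr rfl fun z _ => ?_
  rw [measureReal_preimage_comp hT]

theorem sum_measureReal_preimage [Fintype τ] {T : Ω → τ} (hT : IsRandomVariable T) :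
    ∑ t, P.real (T ⁻¹' {t}) = 1 := by
  have := measureReal_preimage_comp (P := P) hT (fun _ => ()) ()
  simpa using this.symm

end Bridge

/-! ### Conditional entropies of families of variables -/

section Families

variable {τ : Type*} [Fintype τ] {p : τ → ℝ} {ι : Type*} {𝒜 𝒞 : ι → Type*} {ζ : Type*}

theorem fEntropy_const (h1 : ∑ t, p t = 1) {S : Type*} {f : τ → S} (h : ∀ t t', f t = f t') :
    fEntropy p f = 0 := by
  rw [fEntropy_of_fiberMass_eq (N := 1) h1, Real.log_one]
  intro t
  simp [fiberMass, h _ t, h1]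

/-- Conditional entropy is subadditive. -/
theorem fEntropy_restrict_le_sum (hp : ∀ t, 0 ≤ p t) (a : τ → ∀ j, 𝒜 j) (Z : τ → ζ)
    (I : Finset ι) :
    fEntropy p (fun t => ((fun j : I => a t j), Z t)) - fEntropy p Z ≤
      ∑ j ∈ I, (fEntropy p (fun t => (a t j, Z t)) - fEntropy p Z) := by
  classical
  induction I using Finset.induction_on with
  | empty =>
    rw [fEntropy_congr (g := Z) hp]
    · simp
    · intro t t'
      simp [funext_iff]
  | insert i I hi ih =>
    rw [Finset.sum_insert hi]
    have := fEntropy_submodular (p := p) hp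
      (J := fun t => ((fun j : (insert i I : Finset ι) => a t j), Z t)) (M := Z)
      (X := fun t => (a t i, Z t)) (Y := fun t => ((fun j : I => a t j), Z t))
      (by simp only [Prod.mk.injEq, funext_iff, Subtype.forall, Finset.forall_mem_insert]; tauto)
      (by simp) (by simp)
    linarith

/-- Chain rule: on the left each `C j` is conditioned on all answers in `I` and on the earlier `C`,
on the right only on its own answer and `Z`. -/
theorem fEntropy_restrict_given_le_sum (hp : ∀ t, 0 ≤ p t) (a : τ → ∀ j, 𝒜 j)
    (C : τ → ∀ j, 𝒞 j) (Z : τ → ζ) (I : Finset ι) :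
    fEntropy p (fun t => ((fun j : I => C t j), (fun j : I => a t j), Z t)) -
        fEntropy p (fun t => ((fun j : I => a t j), Z t)) ≤
      ∑ j ∈ I, (fEntropy p (fun t => (C t j, a t j, Z t)) -
        fEntropy p (fun t => (a t j, Z t))) := by
  classical
  induction I using Finset.induction_on with
  | empty =>
    rw [fEntropy_congr (f := fun t => ((fun j : (∅ : Finset ι) => C t j),
      (fun j : (∅ : Finset ι) => a t j), Z t)) (g := fun t =>
      ((fun j : (∅ : Finset ι) => a t j), Z t)) hp]
    · simp
    · intro t t'
      simp [funext_iff]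
  | insert i I hi ih =>
    rw [Finset.sum_insert hi]
    have h1 := fEntropy_submodular (p := p) hp
      (J := fun t => ((fun j : I => C t j), (fun j : (insert i I : Finset ι) => a t j), Z t))
      (M := fun t => ((fun j : I => a t j), Z t))
      (X := fun t => ((fun j : I => C t j), (fun j : I => a t j), Z t))
      (Y := fun t => ((fun j : (insert i I : Finset ι) => a t j), Z t))
      (by simp only [Prod.mk.injEq, funext_iff, Subtype.forall, Finset.forall_mem_insert]; tauto)
      (by simp only [Prod.mk.injEq]; tauto)
      (by simp only [Prod.mk.injEq, funext_iff, Subtype.forall, Finset.forall_mem_insert]; tauto)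
    have h2 := fEntropy_submodular (p := p) hp
      (J := fun t => ((fun j : (insert i I : Finset ι) => C t j),
        (fun j : (insert i I : Finset ι) => a t j), Z t))
      (M := fun t => (a t i, Z t))
      (X := fun t => ((fun j : I => C t j), (fun j : (insert i I : Finset ι) => a t j), Z t))
      (Y := fun t => (C t i, a t i, Z t))
      (by simp only [Prod.mk.injEq, funext_iff, Subtype.forall, Finset.forall_mem_insert]; tauto)
      (by simp only [Prod.mk.injEq, funext_iff, Subtype.forall, Finset.forall_mem_insert]; tauto)
      (by simp only [Prod.mk.injEq]; tauto)
    linarith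

/-- If the `C j` with `j ∈ I` are conditionally independent given `Z`, and every `a j` is determined
by `Z` and `C j`, then the `a j` with `j ∈ I` are conditionally independent given `Z`. -/
theorem sum_le_fEntropy_restrict (hp : ∀ t, 0 ≤ p t) (a : τ → ∀ j, 𝒜 j)
    (C : τ → ∀ j, 𝒞 j) (Z : τ → ζ) (I : Finset ι)
    (hdet : ∀ j ∈ I, fEntropy p (fun t => (C t j, a t j, Z t)) ≤ fEntropy p (fun t => (C t j, Z t)))
    (hC : ∑ j ∈ I, (fEntropy p (fun t => (C t j, Z t)) - fEntropy p Z) ≤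
      fEntropy p (fun t => ((fun j : I => C t j), Z t)) - fEntropy p Z) :
    ∑ j ∈ I, (fEntropy p (fun t => (a t j, Z t)) - fEntropy p Z) ≤
      fEntropy p (fun t => ((fun j : I => a t j), Z t)) - fEntropy p Z := by
  -- `H(a_I | Z) ≥ H(C_I | Z) - H(C_I | a_I, Z)`. The first term is at least the sum of the `H(C_j |
  -- Z)`, and `h1` bounds the second by the sum of the `H(C_j | a_j, Z)`. Each difference is at
  -- least `H(a_j | Z)` because `C_j` and `Z` determine `a_j`.
  have h1 := fEntropy_restrict_given_le_sum hp a C Z I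
  have h2 : fEntropy p (fun t => ((fun j : I => C t j), Z t)) ≤
      fEntropy p (fun t => ((fun j : I => C t j), (fun j : I => a t j), Z t)) :=
    fEntropy_mono hp (by simp only [Prod.mk.injEq]; tauto)
  have h3 := Finset.sum_le_sum hdet
  simp only [Finset.sum_sub_distrib] at *
  linarith

end Families

/-! ### Independence and uniform distributions -/

section Independence

variable {τ : Type*} [Fintype τ] {p : τ → ℝ} {A B S T : Type*}

/-- Functions of independent variables are independent. -/
theorem fEntropy_pair_of_indep (hp : ∀ t, 0 ≤ p t) (h1 : ∑ t, p t = 1) {w : τ → A} {q : τ → B}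
    (hind : fEntropy p (fun t => (w t, q t)) = fEntropy p w + fEntropy p q)
    {x : τ → S} {y : τ → T} (hx : ∀ t t', w t = w t' → x t = x t')
    (hy : ∀ t t', q t = q t' → y t = y t') :
    fEntropy p (fun t => (x t, y t)) = fEntropy p x + fEntropy p y := by
  have e1 := fEntropy_submodular (p := p) hp (J := fun t => (x t, y t)) (M := fun _ => ())
    (X := x) (Y := y) (by simp +contextual) (by simp) (by simp)
  rw [fEntropy_const (f := fun _ => ()) h1 fun _ _ => rfl] at e1
  -- Refining `x` to `w`, and then `y` to `q`, can only increase the mutual information, which is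
  -- zero at the end by `hind`.
  have e2 := fEntropy_submodular (p := p) hp (J := fun t => (w t, y t)) (M := x)
    (X := w) (Y := fun t => (x t, y t)) (by simp +contextual) hx (by simp +contextual)
  have e3 := fEntropy_submodular (p := p) hp (J := fun t => (w t, q t)) (M := y)
    (X := fun t => (w t, y t)) (Y := q) (by simp +contextual) (by simp +contextual) hy
  linarith

end Independence

section Uniform

variable {τ : Type*} [Fintype τ] {p : τ → ℝ} {A B : Type*} [AddCommGroup A] [Fintype A]
  [AddCommGroup B] [Fintype B]

theorem card_fiber_addMonoidHom {φ : A →+ B} (hφ : Function.Surjective φ) [DecidableEq B] (b : B) :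
    (Finset.univ.filter fun x => φ x = b).card * Fintype.card B = Fintype.card A := by
  have h : ∀ b', (Finset.univ.filter fun x => φ x = b').card =
      (Finset.univ.filter fun x => φ x = b).card := by
    intro b'
    obtain ⟨c, hc⟩ := hφ (b - b')
    refine Finset.card_bij (fun x _ => x + c) ?_ ?_ ?_
    · intro x hx
      simp only [Finset.mem_filter, Finset.mem_univ, true_and] at hx ⊢
      simp [hx, hc]
    · intro x _ y _ h
      exact add_right_cancel h
    · intro x hx
      simp only [Finset.mem_filter, Finset.mem_univ, true_and] at hx
      exact ⟨x - c, by simp [hx, hc], by simp⟩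
  have := Finset.card_eq_sum_card_fiberwise (f := φ) (s := Finset.univ) (t := Finset.univ)
    (fun _ _ => by simp)
  rw [Finset.sum_congr rfl fun b' _ => h b', Finset.sum_const] at this
  simp only [Finset.card_univ, smul_eq_mul] at this
  rw [this, mul_comm]

open Classical in
/-- A surjective homomorphic image of a uniformly distributed variable is uniformly distributed. -/
theorem fEntropy_of_surjective {w : τ → A} (h1 : ∑ t, p t = 1)
    (hw : ∀ x, (∑ t, if w t = x then p t else 0) = 1 / (Fintype.card A : ℝ))
    (φ : A →+ B) (hφ : Function.Surjective φ) :
    fEntropy p (fun t => φ (w t)) = Real.log (Fintype.card B) := by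
  apply fEntropy_of_fiberMass_eq h1
  intro t
  have e : fiberMass p (fun t => φ (w t)) t =
      ∑ x, if φ x = φ (w t) then ∑ s, if w s = x then p s else 0 else 0 := by
    simp only [fiberMass, ← Finset.sum_filter]
    rw [Finset.sum_filter, Finset.sum_comm' (t' := Finset.univ) (s' := fun s =>
      if φ (w s) = φ (w t) then {w s} else ∅)]
    · refine Finset.sum_congr rfl fun s _ => ?_
      split_ifs <;> simp
    · intro x s
      simp only [Finset.mem_filter, Finset.mem_univ, true_and, and_true]
      split_ifs with h
      · simp only [Finset.mem_singleton]
        exact ⟨fun h => h.2.symm, fun h' => ⟨h' ▸ h, h'.symm⟩⟩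
      · simp only [Finset.notMem_empty, iff_false]
        rintro ⟨h', rfl⟩
        exact h h'
  rw [e]
  simp only [hw]
  rw [← Finset.sum_filter, Finset.sum_const, nsmul_eq_mul]
  have hc := card_fiber_addMonoidHom hφ (φ (w t))
  have hA : (Fintype.card A : ℝ) ≠ 0 := by simp
  have hB : (Fintype.card B : ℝ) ≠ 0 := by simp
  field_simp
  exact_mod_cast hc

end Uniform

/-! ### Independent rows and information sets -/

section Rows

variable {F : Type*} [Field F]

theorem mulVec_surjective_of_linearIndependent {ι κ : Type*} [Fintype ι] [Fintype κ]
    {M : Matrix ι κ F} (h : LinearIndependent F M.row) : Function.Surjective M.mulVec := by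
  have hr : Module.finrank F (LinearMap.range M.mulVecLin) = Module.finrank F (ι → F) := by
    rw [Module.finrank_fintype_fun_eq_card, ← h.rank_matrix, Matrix.rank]
  exact LinearMap.range_eq_top.1 (Submodule.eq_top_of_finrank_eq hr)

/-- The rows of a matrix contain as many linearly independent ones as the rank of the matrix. -/
theorem exists_linearIndependent_rows {μ f : ℕ} (V : Matrix (Fin μ) (Fin f) F) :
    ∃ B : Finset (Fin μ), B.card = V.rank ∧ LinearIndependent F (fun v : B => V v) := by
  classical
  obtain ⟨b, -, -, hspan, hli⟩ := exists_linearIndepOn_extension (K := F) (v := V.row)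
    (linearIndepOn_empty F _) (Set.subset_univ ∅)
  rw [Set.image_univ] at hspan
  have hb : LinearIndependent F (fun v : b.toFinset => V v) :=
    hli.comp (fun v : b.toFinset => ⟨v, Set.mem_toFinset.1 v.2⟩)
      fun v v' h => Subtype.ext (Subtype.mk.inj h)
  refine ⟨b.toFinset, ?_, hb⟩
  have hrange : (Set.range fun v : b.toFinset => V v) = V.row '' b := by
    ext x
    simp only [Set.mem_range, Subtype.exists, Set.mem_toFinset, exists_prop]
    rfl
  rw [Matrix.rank_eq_finrank_span_row, ← Fintype.card_coe, ← finrank_span_eq_card hb, hrange,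
    le_antisymm (Submodule.span_le.2 hspan) (Submodule.span_mono (Set.image_subset_range _ _))]

end Rows

section InformationSets

variable {F : Type*} [Field F] {k n ν : ℕ} {G : Matrix (Fin k) (Fin n) F}

theorem IsInformationSet.card_eq {I : Finset (Fin n)} (h : IsInformationSet G I) : I.card = k := by
  obtain ⟨e, -⟩ := h
  simpa using (Fintype.card_congr e).symm

/-- A module-valued message is determined by its code symbols on an information set. -/
theorem IsInformationSet.eq_zero {I : Finset (Fin n)} (h : IsInformationSet G I) {M : Type*}
    [AddCommGroup M] [Module F M] {x : Fin k → M} (hx : ∀ j ∈ I, ∑ a, G a j • x a = 0) : x = 0 := by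
  obtain ⟨e, hu⟩ := h
  obtain ⟨B, hB⟩ := hu.exists_right_inv
  funext a
  have : x a = ∑ b, B b a • ∑ c, G c (e b) • x c := by
    simp only [Finset.smul_sum, smul_smul]
    rw [Finset.sum_comm]
    have h1 : ∀ c, ∑ b, (B b a * G c (e b)) • x c = (1 : Matrix (Fin k) (Fin k) F) c a • x c := by
      intro c
      rw [← hB, Matrix.mul_apply, Finset.sum_smul]
      simp [mul_comm]
    simp [h1, Matrix.one_apply]
  rw [this]
  simp [hx _ (e _).2]

theorem IsInformationSet.exists_ne_zero {I : Finset (Fin n)} (h : IsInformationSet G I) {j : Fin n}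
    (hj : j ∈ I) : ∃ a, G a j ≠ 0 := by
  obtain ⟨e, hu⟩ := h
  obtain ⟨B, hB⟩ := hu.exists_left_inv
  by_contra! h0
  have := congrFun (congrFun hB (e.symm ⟨j, hj⟩)) (e.symm ⟨j, hj⟩)
  simp [Matrix.mul_apply, h0] at this

/-- If the code is MDS-PIR capacity-achieving, there is a family of `ν` information sets, such that
every coordinate is contained in exactly `κ` of them. -/
theorem IsMDSPIRCapacityAchieving.exists_informationSets (hC : IsMDSPIRCapacityAchieving G)
    (hn : 0 < n) : ∃ (κ ν : ℕ) (I : Fin ν → Finset (Fin n)), 0 < ν ∧ κ * n = k * ν ∧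
      (∀ u, IsInformationSet G (I u)) ∧
      ∀ j, (Finset.univ.filter fun u => j ∈ I u).card = κ := by
  obtain ⟨κ, ν, Λ, hν, hκ, hcol, hrow⟩ := hC
  have hκ' : κ * n = k * ν := by
    have : (ν : ℚ) ≠ 0 := by positivity
    have : (n : ℚ) ≠ 0 := by positivity
    field_simp at hκ
    exact_mod_cast (by linarith : (κ : ℚ) * n = k * ν)
  choose I hI hinf using hrow
  -- Counting ones by columns gives `nκ = νk`. Each of the `ν` row supports contains a set of size
  -- `k`, so no support can be larger.
  have hsum : ∑ u, (I u).card =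
      ∑ u, (Finset.univ.filter (fun j : Fin n => Λ u j = true)).card := by
    have h1 : ∑ u, (Finset.univ.filter (fun j : Fin n => Λ u j = true)).card = n * κ := by
      simp only [Finset.card_filter]
      rw [Finset.sum_comm]
      simp only [← Finset.card_filter, hcol]
      simp
    rw [h1]
    simp [(hinf _).card_eq]
    linarith
  have heq : ∀ u, I u = Finset.univ.filter (fun j : Fin n => Λ u j = true) := by
    intro u
    refine Finset.eq_of_subset_of_card_le (hI u) ?_
    exact ((Finset.sum_eq_sum_iff_of_le fun u _ => Finset.card_le_card (hI u)).1 hsum u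
      (Finset.mem_univ u)).ge
  refine ⟨κ, ν, I, hν, hκ', hinf, fun j => ?_⟩
  rw [← hcol j]
  simp [heq]

end InformationSets

/-! ### Evaluations and stored contents as linear maps of the messages -/

section MessageMaps

variable {F : Type*} [Field F] {k n f μ β : ℕ} {G : Matrix (Fin k) (Fin n) F}
  {V : Matrix (Fin μ) (Fin f) F}

/-- The evaluations of the candidate functions with index in `S`. -/
def evaluationOn (V : Matrix (Fin μ) (Fin f) F) (S : Finset (Fin μ)) (w : Messages F f β k) :
    S → Fin β × Fin k → F :=
  fun v => evaluation V w v

/-- The candidate functions with index in `S`, applied to the content of a database. -/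
def storedOn (V : Matrix (Fin μ) (Fin f) F) (S : Finset (Fin μ)) (c : Fin f → Fin β → F) :
    S → Fin β → F :=
  fun v i => V.mulVec (fun m => c m i) v

theorem stored_apply (w : Messages F f β k) (j : Fin n) (m : Fin f) (i : Fin β) :
    stored G w j m i = ∑ a, w m i a * G a j := rfl

theorem evaluation_apply (w : Messages F f β k) (v : Fin μ) (l : Fin β × Fin k) :
    evaluation V w v l = ∑ m, V v m * w m l.1 l.2 := rfl

theorem storedOn_stored (S : Finset (Fin μ)) (w : Messages F f β k) (j : Fin n) (v : S)
    (i : Fin β) : storedOn V S (stored G w j) v i = ∑ a, evaluationOn V S w v (i, a) * G a j := by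
  simp only [storedOn, Matrix.mulVec, dotProduct, stored_apply, evaluationOn, evaluation_apply,
    Finset.mul_sum, Finset.sum_mul, mul_assoc]
  exact Finset.sum_comm

theorem evaluationOn_surjective {S : Finset (Fin μ)} (hS : LinearIndependent F fun v : S => V v) :
    Function.Surjective (evaluationOn (β := β) (k := k) V S) := by
  intro y
  have h := mulVec_surjective_of_linearIndependent (M := Matrix.of fun v : S => V v) hS
  choose x hx using fun l => h fun v => y v l
  refine ⟨fun m i a => x (i, a) m, ?_⟩
  funext v l
  exact congrFun (hx l) v

theorem storedOn_surjective {S : Finset (Fin μ)} (hS : LinearIndependent F fun v : S => V v) :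
    Function.Surjective (storedOn (β := β) V S) := by
  intro y
  have h := mulVec_surjective_of_linearIndependent (M := Matrix.of fun v : S => V v) hS
  choose x hx using fun l => h fun v => y v l
  refine ⟨fun m i => x i m, ?_⟩
  funext v l
  exact congrFun (hx l) v

theorem stored_surjective {j : Fin n} (hj : ∃ a, G a j ≠ 0) :
    Function.Surjective fun w : Messages F f β k => stored G w j := by
  intro y
  obtain ⟨a, ha⟩ := hj
  refine ⟨fun m i => Pi.single a (y m i / G a j), ?_⟩
  funext m i
  simp [stored, ha]

theorem IsInformationSet.stored_injective {I : Finset (Fin n)} (h : IsInformationSet G I)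
    {w w' : Messages F f β k} (hw : ∀ j ∈ I, stored G w j = stored G w' j) : w = w' := by
  funext m i
  rw [← sub_eq_zero]
  refine h.eq_zero fun j hj => ?_
  have := congrFun (congrFun (hw j hj) m) i
  simp only [stored_apply] at this
  simp only [Pi.sub_apply, smul_eq_mul, mul_sub, Finset.sum_sub_distrib]
  simp only [mul_comm (G _ _), this, sub_self]

/-- `evaluationOn` as a homomorphism. -/
def evaluationOnHom (V : Matrix (Fin μ) (Fin f) F) (S : Finset (Fin μ)) :
    Messages F f β k →+ (S → Fin β × Fin k → F) :=
  AddMonoidHom.mk' (evaluationOn V S) fun w w' => by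
    funext v l
    simp [evaluationOn, evaluation_apply, mul_add, Finset.sum_add_distrib]

/-- `stored` as a homomorphism. -/
def storedHom (G : Matrix (Fin k) (Fin n) F) (j : Fin n) :
    Messages F f β k →+ (Fin f → Fin β → F) :=
  AddMonoidHom.mk' (fun w => stored G w j) fun w w' => by
    funext m i
    simp [stored_apply, add_mul, Finset.sum_add_distrib]

/-- `storedOn` as a homomorphism. -/
def storedOnHom (V : Matrix (Fin μ) (Fin f) F) (S : Finset (Fin μ)) :
    (Fin f → Fin β → F) →+ (S → Fin β → F) :=
  AddMonoidHom.mk' (storedOn V S) fun w w' => by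
    funext v l
    simp [storedOn, Matrix.mulVec, dotProduct, mul_add, Finset.sum_add_distrib]

end MessageMaps

/-! ### Converse: one step of the recursion -/

section Converse

variable {F : Type*} [Field F] [Fintype F] {k n f μ β : ℕ} {G : Matrix (Fin k) (Fin n) F}
  {V : Matrix (Fin μ) (Fin f) F} {τ : Type*} [Fintype τ] {p : τ → ℝ}
  {𝒬 : Type*} {𝒜 : Fin n → Type*}
  {w : τ → Messages F f β k} {q : τ → Fin n → 𝒬} {a : τ → ∀ j, 𝒜 j}

section Uniform

variable [DecidableEq (Messages F f β k)] (h1 : ∑ t, p t = 1)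
  (hw : ∀ x, (∑ t, if w t = x then p t else 0) = 1 / (Fintype.card (Messages F f β k) : ℝ))

include h1 hw

theorem fEntropy_hom {B : Type*} [AddCommGroup B] [Fintype B] (φ : Messages F f β k →+ B)
    (hφ : Function.Surjective φ) :
    fEntropy p (fun t => φ (w t)) = Real.log (Fintype.card B) := by
  refine fEntropy_of_surjective h1 (fun x => ?_) φ hφ
  rw [← hw x]
  congr!

theorem fEntropy_messages :
    fEntropy p w = (f * (β * k) : ℕ) * Real.log (Fintype.card F) := by
  rw [show fEntropy p w = fEntropy p (fun t => AddMonoidHom.id _ (w t)) from rfl,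
    fEntropy_hom h1 hw _ Function.surjective_id]
  simp only [Fintype.card_fun, Fintype.card_fin, ← pow_mul, Nat.cast_pow, Real.log_pow]
  congr 2
  ring

theorem fEntropy_evaluationOn {S : Finset (Fin μ)}
    (hS : LinearIndependent F fun v : S => V v) :
    fEntropy p (fun t => evaluationOn V S (w t)) =
      (S.card * (β * k) : ℕ) * Real.log (Fintype.card F) := by
  rw [show (fun t => evaluationOn V S (w t)) = fun t => evaluationOnHom V S (w t) from rfl,
    fEntropy_hom h1 hw _ (evaluationOn_surjective hS)]
  simp only [Fintype.card_fun, Fintype.card_fin, Fintype.card_prod, Fintype.card_coe, ← pow_mul,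
    Nat.cast_pow, Real.log_pow]
  congr 2
  ring

theorem fEntropy_stored {j : Fin n} (hj : ∃ a, G a j ≠ 0) :
    fEntropy p (fun t => stored G (w t) j) = (f * β : ℕ) * Real.log (Fintype.card F) := by
  rw [show (fun t => stored G (w t) j) = fun t => storedHom G j (w t) from rfl,
    fEntropy_hom h1 hw _ (stored_surjective hj)]
  simp only [Fintype.card_fun, Fintype.card_fin, ← pow_mul, Nat.cast_pow, Real.log_pow]
  congr 2
  ring

theorem fEntropy_storedOn {S : Finset (Fin μ)} (hS : LinearIndependent F fun v : S => V v)
    {j : Fin n} (hj : ∃ a, G a j ≠ 0) :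
    fEntropy p (fun t => storedOn V S (stored G (w t) j)) =
      (S.card * β : ℕ) * Real.log (Fintype.card F) := by
  rw [show (fun t => storedOn V S (stored G (w t) j)) =
      fun t => ((storedOnHom V S).comp (storedHom G j)) (w t) from rfl,
    fEntropy_hom h1 hw _ ((storedOn_surjective hS).comp (stored_surjective hj))]
  simp only [Fintype.card_fun, Fintype.card_fin, Fintype.card_coe, ← pow_mul, Nat.cast_pow,
    Real.log_pow]
  congr 2
  ring

end Uniform

variable (hp : ∀ t, 0 ≤ p t) (h1 : ∑ t, p t = 1)
  (hind : fEntropy p (fun t => (w t, q t)) = fEntropy p w + fEntropy p q)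

include hp h1 hind

/-- The recovery of a new linear function increases the conditional entropy of the answers. -/
theorem fEntropy_answers_ge_of_recovery [DecidableEq (Messages F f β k)]
    (hw : ∀ x, (∑ t, if w t = x then p t else 0) = 1 / (Fintype.card (Messages F f β k) : ℝ))
    {v : Fin μ}
    (hrec : fEntropy p (fun t => (evaluation V (w t) v, a t, q t)) = fEntropy p fun t => (a t, q t))
    {S : Finset (Fin μ)} (hv : v ∉ S)
    (hS : LinearIndependent F fun x : (insert v S : Finset (Fin μ)) => V x) :
    ((β * k : ℕ) : ℝ) * Real.log (Fintype.card F) +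
      (fEntropy p (fun t => (a t, evaluationOn V (insert v S) (w t), q t)) -
        fEntropy p fun t => (evaluationOn V (insert v S) (w t), q t)) ≤
      fEntropy p (fun t => (a t, evaluationOn V S (w t), q t)) -
        fEntropy p fun t => (evaluationOn V S (w t), q t) := by
  have hS' : LinearIndependent F fun x : S => V x :=
    hS.comp (fun x : S => ⟨x, Finset.mem_insert_of_mem x.2⟩)
      fun x y h => Subtype.ext (Subtype.mk.inj h)
  have e1 := fEntropy_pair_of_indep hp h1 hind (x := fun t => evaluationOn V S (w t)) (y := q)
    (fun t t' h => by simp only [h]) (fun t t' h => h)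
  have e2 := fEntropy_pair_of_indep hp h1 hind (x := fun t => evaluationOn V (insert v S) (w t))
    (y := q) (fun t t' h => by simp only [h]) (fun t t' h => h)
  -- With `hrec`, this says that adjoining the evaluation of `v` to the answers, the queries and
  -- `X_S` costs no entropy. Without the answers it costs exactly `βk` symbols, by `e1` and `e2`.
  have e3 := fEntropy_submodular (p := p) hp
    (J := fun t => (a t, evaluationOn V (insert v S) (w t), q t)) (M := fun t => (a t, q t))
    (X := fun t => (evaluation V (w t) v, a t, q t))
    (Y := fun t => (a t, evaluationOn V S (w t), q t))
    (by
      simp only [Prod.mk.injEq, funext_iff (f := evaluationOn _ _ _), Subtype.forall,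
        Finset.forall_mem_insert, evaluationOn]
      tauto)
    (by simp only [Prod.mk.injEq]; tauto) (by simp only [Prod.mk.injEq]; tauto)
  rw [fEntropy_evaluationOn h1 hw hS'] at e1
  rw [fEntropy_evaluationOn h1 hw hS, Finset.card_insert_of_notMem hv] at e2
  push_cast at e1 e2 ⊢
  linarith

variable {S : Finset (Fin μ)}

omit [Fintype F] in
/-- Given the evaluations in `S`, the answer of a database depends only on the query to that
database. -/
theorem fEntropy_answer_le_of_local {j : Fin n}
    (hdet : fEntropy p (fun t => (a t j, q t j, stored G (w t) j)) =
      fEntropy p fun t => (q t j, stored G (w t) j)) :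
    fEntropy p (fun t => (a t j, evaluationOn V S (w t), q t j)) -
        fEntropy p (fun t => (evaluationOn V S (w t), q t j)) ≤
      fEntropy p (fun t => (a t j, evaluationOn V S (w t), q t)) -
        fEntropy p (fun t => (evaluationOn V S (w t), q t)) := by
  have e1 := fEntropy_pair_of_indep hp h1 hind (x := fun t => evaluationOn V S (w t)) (y := q)
    (fun t t' h => by simp only [h]) (fun t t' h => h)
  have e2 := fEntropy_pair_of_indep hp h1 hind (x := fun t => evaluationOn V S (w t))
    (y := fun t => q t j) (fun t t' h => by simp only [h]) (fun t t' h => by simp only [h])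
  have e3 := fEntropy_pair_of_indep hp h1 hind (x := w)
    (y := fun t => q t j) (fun t t' h => h) (fun t t' h => by simp only [h])
  -- The answer adds no entropy to the messages and query `j`. Given query `j`, the other queries
  -- are independent of the messages, so they carry no further information about the answer.
  have e4 := fEntropy_submodular (p := p) hp (J := fun t => (a t j, w t, q t j))
    (M := fun t => (q t j, stored G (w t) j)) (X := fun t => (a t j, q t j, stored G (w t) j))
    (Y := fun t => (w t, q t j)) (by simp +contextual) (by simp +contextual) (by simp +contextual)
  have e5 := fEntropy_submodular (p := p) hp (J := fun t => (a t j, w t, q t))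
    (M := fun t => (a t j, evaluationOn V S (w t), q t j))
    (X := fun t => (a t j, evaluationOn V S (w t), q t))
    (Y := fun t => (a t j, w t, q t j)) (by simp +contextual) (by simp +contextual)
    (by simp +contextual)
  have e6 := fEntropy_mono hp (f := fun t => (w t, q t)) (g := fun t => (a t j, w t, q t))
    (by simp +contextual)
  linarith

/-- Given the evaluations in `S` and the queries, the contents of the databases in an information
set are independent. -/
theorem sum_fEntropy_stored_le [DecidableEq (Messages F f β k)]
    (hw : ∀ x, (∑ t, if w t = x then p t else 0) = 1 / (Fintype.card (Messages F f β k) : ℝ))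
    (hS : LinearIndependent F fun v : S => V v) {I : Finset (Fin n)} (hI : IsInformationSet G I) :
    ∑ j ∈ I, (fEntropy p (fun t => (stored G (w t) j, evaluationOn V S (w t), q t)) -
        fEntropy p fun t => (evaluationOn V S (w t), q t)) ≤
      fEntropy p (fun t => ((fun j : I => stored G (w t) j), evaluationOn V S (w t), q t)) -
        fEntropy p fun t => (evaluationOn V S (w t), q t) := by
  have e1 := fEntropy_pair_of_indep hp h1 hind (x := fun t => evaluationOn V S (w t)) (y := q)
    (fun t t' h => by simp only [h]) (fun t t' h => h)
  have e2 := fEntropy_mono hp (f := fun t => (w t, q t))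
    (g := fun t => ((fun j : I => stored G (w t) j), evaluationOn V S (w t), q t)) (by
      intro t t' h
      simp only [Prod.mk.injEq, funext_iff (f := fun j : I => _), Subtype.forall] at h ⊢
      exact ⟨hI.stored_injective h.1, h.2.2⟩)
  rw [hind] at e2
  -- The content of a database has `fβ` symbols, of which `|S|β` independent linear combinations are
  -- already known from `X_S`. The `k` contents together determine the messages, whose remaining
  -- entropy is `k(f - |S|)β`, so all these bounds are tight.
  have e3 : ∀ j ∈ I, fEntropy p (fun t => (stored G (w t) j, evaluationOn V S (w t), q t)) -
      fEntropy p (fun t => (evaluationOn V S (w t), q t)) ≤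
      ((f * β : ℕ) - (S.card * β : ℕ)) * Real.log (Fintype.card F) := by
    intro j hj
    have hG := hI.exists_ne_zero hj
    have d1 := fEntropy_pair_of_indep hp h1 hind
      (x := fun t => (stored G (w t) j, evaluationOn V S (w t))) (y := q)
      (fun t t' h => by simp only [h]) (fun t t' h => h)
    have d2 := fEntropy_submodular (p := p) hp
      (J := fun t => (stored G (w t) j, evaluationOn V S (w t)))
      (M := fun t => storedOn V S (stored G (w t) j)) (X := fun t => stored G (w t) j)
      (Y := fun t => evaluationOn V S (w t)) (by simp +contextual) (by simp +contextual)
      (fun t t' h => by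
        funext v i
        simp only [storedOn_stored, h])
    have d3 := fEntropy_congr hp
      (f := fun t => (stored G (w t) j, evaluationOn V S (w t), q t))
      (g := fun t => ((stored G (w t) j, evaluationOn V S (w t)), q t))
      (by simp [and_assoc])
    rw [fEntropy_stored h1 hw hG, fEntropy_storedOn h1 hw hS hG] at d2
    linarith
  refine (Finset.sum_le_sum e3).trans ?_
  rw [fEntropy_messages h1 hw] at e2
  rw [Finset.sum_const, hI.card_eq, nsmul_eq_mul, e1, fEntropy_evaluationOn h1 hw hS]
  rw [e1.symm] at *
  push_cast at *
  linarith

/-- Answers inherit conditional independence from the contents in an information set, by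
`sum_le_fEntropy_restrict`. The conditioning on all queries is weakened to query `j` alone because
only that form is controlled by privacy. -/
theorem sum_fEntropy_answer_le [DecidableEq (Messages F f β k)]
    (hw : ∀ x, (∑ t, if w t = x then p t else 0) = 1 / (Fintype.card (Messages F f β k) : ℝ))
    (hdet : ∀ j, fEntropy p (fun t => (a t j, q t j, stored G (w t) j)) =
      fEntropy p fun t => (q t j, stored G (w t) j))
    (hS : LinearIndependent F fun v : S => V v) {I : Finset (Fin n)} (hI : IsInformationSet G I) :
    ∑ j ∈ I, (fEntropy p (fun t => (a t j, evaluationOn V S (w t), q t j)) -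
        fEntropy p fun t => (evaluationOn V S (w t), q t j)) ≤
      fEntropy p (fun t => (a t, evaluationOn V S (w t), q t)) -
        fEntropy p fun t => (evaluationOn V S (w t), q t) := by
  have e1 := Finset.sum_le_sum fun j (_ : j ∈ I) =>
    fEntropy_answer_le_of_local (V := V) (S := S) hp h1 hind (hdet j)
  have e2 := sum_le_fEntropy_restrict hp a (fun t => stored G (w t))
    (fun t => (evaluationOn V S (w t), q t)) I ?_
    (sum_fEntropy_stored_le hp h1 hind hw hS hI)
  · have e3 := fEntropy_mono hp
      (f := fun t => ((fun j : I => a t j), evaluationOn V S (w t), q t))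
      (g := fun t => (a t, evaluationOn V S (w t), q t)) (by simp +contextual)
    linarith
  · intro j _
    have := fEntropy_submodular (p := p) hp
      (J := fun t => (stored G (w t) j, a t j, evaluationOn V S (w t), q t))
      (M := fun t => (q t j, stored G (w t) j)) (X := fun t => (a t j, q t j, stored G (w t) j))
      (Y := fun t => (stored G (w t) j, evaluationOn V S (w t), q t))
      (by simp +contextual) (by simp +contextual) (by simp +contextual)
    linarith [hdet j]

omit [Fintype F] h1 hind in
/-- The answers have at most the sum of their conditional entropies. -/
theorem fEntropy_answers_le_sum :
    fEntropy p (fun t => (a t, evaluationOn V S (w t), q t)) -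
        fEntropy p (fun t => (evaluationOn V S (w t), q t)) ≤
      ∑ j, (fEntropy p (fun t => (a t j, evaluationOn V S (w t), q t j)) -
        fEntropy p fun t => (evaluationOn V S (w t), q t j)) := by
  have e1 := fEntropy_restrict_le_sum hp a (fun t => (evaluationOn V S (w t), q t)) Finset.univ
  have e2 := fEntropy_mono hp (f := fun t => (a t, evaluationOn V S (w t), q t))
    (g := fun t => ((fun j : (Finset.univ : Finset (Fin n)) => a t j),
      evaluationOn V S (w t), q t)) (by
      simp only [Prod.mk.injEq, funext_iff, Subtype.forall, Finset.mem_univ, forall_const]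
      tauto)
  refine (sub_le_sub_right e2 _).trans (e1.trans (Finset.sum_le_sum fun j _ => ?_))
  have := fEntropy_submodular (p := p) hp (J := fun t => (a t j, evaluationOn V S (w t), q t))
    (M := fun t => (evaluationOn V S (w t), q t j))
    (X := fun t => (a t j, evaluationOn V S (w t), q t j))
    (Y := fun t => (evaluationOn V S (w t), q t)) (by simp +contextual) (by simp +contextual)
    (by simp +contextual)
  linarith

end Converse

/-! ### Converse: recursion over independent candidates -/

section Converse

variable {F : Type*} [Field F] [Fintype F] {k n f μ : ℕ} {G : Matrix (Fin k) (Fin n) F}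
  {V : Matrix (Fin μ) (Fin f) F}

/-- A lower bound for the sum of the conditional entropies of the answers given the evaluations in
`S`, by induction on the number of independent functions that are not in `S`. -/
theorem sum_fEntropy_answer_ge {β : ℕ} {τ : Type*} [Fintype τ] {p : Fin μ → τ → ℝ}
    {𝒬 : Type*} {𝒜 : Fin n → Type*} {w : τ → Messages F f β k} {q : τ → Fin n → 𝒬}
    {a : τ → ∀ j, 𝒜 j} [DecidableEq (Messages F f β k)] (hp : ∀ v t, 0 ≤ p v t)
    (h1 : ∀ v, ∑ t, p v t = 1)
    (hw : ∀ v x, (∑ t, if w t = x then p v t else 0) =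
      1 / (Fintype.card (Messages F f β k) : ℝ))
    (hind : ∀ v, fEntropy (p v) (fun t => (w t, q t)) = fEntropy (p v) w + fEntropy (p v) q)
    (hdet : ∀ v j, fEntropy (p v) (fun t => (a t j, q t j, stored G (w t) j)) =
      fEntropy (p v) fun t => (q t j, stored G (w t) j))
    (hrec : ∀ v, fEntropy (p v) (fun t => (evaluation V (w t) v, a t, q t)) =
      fEntropy (p v) fun t => (a t, q t))
    (hpriv : ∀ v v' j (S : Finset (Fin μ)),
      fEntropy (p v) (fun t => (a t j, evaluationOn V S (w t), q t j)) -
        fEntropy (p v) (fun t => (evaluationOn V S (w t), q t j)) =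
      fEntropy (p v') (fun t => (a t j, evaluationOn V S (w t), q t j)) -
        fEntropy (p v') (fun t => (evaluationOn V S (w t), q t j)))
    {κ ν : ℕ} {I : Fin ν → Finset (Fin n)} (hν : 0 < ν) (hI : ∀ u, IsInformationSet G (I u))
    (hκ : ∀ j, (Finset.univ.filter fun u => j ∈ I u).card = κ)
    {B : Finset (Fin μ)} (hB : LinearIndependent F fun v : B => V v) (m : ℕ) :
    ∀ S ⊆ B, (B \ S).card = m → ∀ v₀,
      ((β * k : ℕ) : ℝ) * Real.log (Fintype.card F) * ∑ t ∈ Finset.range m, ((κ : ℝ) / ν) ^ t ≤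
        ∑ j, (fEntropy (p v₀) (fun t => (a t j, evaluationOn V S (w t), q t j)) -
          fEntropy (p v₀) fun t => (evaluationOn V S (w t), q t j)) := by
  have hB' : ∀ S ⊆ B, LinearIndependent F fun v : S => V v := fun S hS =>
    hB.comp (fun x : S => ⟨x, hS x.2⟩) fun x y h => Subtype.ext (Subtype.mk.inj h)
  induction m with
  | zero =>
    intro S hS _ v₀
    simp only [Finset.range_zero, Finset.sum_empty, mul_zero]
    exact Finset.sum_nonneg fun j _ => sub_nonneg.2 (fEntropy_mono (hp v₀) (by simp +contextual))
  | succ m ih =>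
    intro S hS hm v₀
    obtain ⟨v, hv⟩ : (B \ S).Nonempty := by rw [← Finset.card_pos]; omega
    obtain ⟨hvB, hvS⟩ := Finset.mem_sdiff.1 hv
    have hS' : insert v S ⊆ B := Finset.insert_subset hvB hS
    -- Privacy makes the desired index the new candidate `v`, so that recovery can add it to `S`.
    rw [Finset.sum_congr rfl fun j _ => hpriv v₀ v j S]
    refine le_trans ?_ (fEntropy_answers_le_sum (hp v))
    refine le_trans ?_ (fEntropy_answers_ge_of_recovery (hp v) (h1 v) (hind v) (hw v) (hrec v) hvS
      (hB' _ hS'))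
    have hcard : (B \ insert v S).card = m := by
      rw [Finset.sdiff_insert, Finset.card_erase_of_mem hv, hm, Nat.add_sub_cancel]
    have e1 := ih _ hS' hcard v
    have e2 := Finset.sum_le_sum fun u (_ : u ∈ Finset.univ) =>
      sum_fEntropy_answer_le (hp v) (h1 v) (hind v) (hw v) (hdet v) (hB' _ hS') (hI u)
    -- Summing over the `ν` information sets counts every database `κ` times.
    rw [Finset.sum_const, Finset.card_univ, Fintype.card_fin, nsmul_eq_mul,
      Finset.sum_comm' (t' := Finset.univ) (s' := fun j => Finset.univ.filter fun u => j ∈ I u)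
        (by simp)] at e2
    simp only [Finset.sum_const, hκ, nsmul_eq_mul, ← Finset.mul_sum] at e2
    rw [geom_sum_succ]
    have e3 := mul_le_mul_of_nonneg_left e1 (Nat.cast_nonneg (α := ℝ) κ)
    have hν' : (0 : ℝ) < ν := by exact_mod_cast hν
    have e4 := (div_le_iff₀' hν').2 (e3.trans e2)
    rw [mul_add, mul_one, add_comm]
    refine add_le_add_right (le_trans (le_of_eq ?_) e4) _
    ring

variable (p : PLCProtocol G V)

theorem one_lt_card_cast : (1 : ℝ) < Fintype.card F := by
  exact_mod_cast Fintype.one_lt_card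

theorem log_card_pos : 0 < Real.log (Fintype.card F) := Real.log_pos one_lt_card_cast

theorem PLCProtocol.sum_entropy_answer_ge (v : Fin μ)
    {κ ν : ℕ} {I : Fin ν → Finset (Fin n)} (hν : 0 < ν) (hI : ∀ u, IsInformationSet G (I u))
    (hκ : ∀ j, (Finset.univ.filter fun u => j ∈ I u).card = κ) :
    ((p.β * k : ℕ) : ℝ) * ∑ t ∈ Finset.range V.rank, ((κ : ℝ) / ν) ^ t ≤
      ∑ j : Fin n, entropy (Fintype.card F) p.P (p.A v j) := by
  classical
  obtain ⟨B, hBcard, hB⟩ := exists_linearIndependent_rows V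
  -- All desired indices share this finite outcome space and the same coordinate functions; only the
  -- weights, the law of `T v`, depend on `v`.
  set τ := Messages F f p.β k × (Fin n → p.Query) × (∀ j, p.Answer j)
  let T : Fin μ → p.Ω → τ := fun v ω => (p.W ω, (fun j => p.Q v j ω), fun j => p.A v j ω)
  have hT : ∀ v, IsRandomVariable (T v) := fun v =>
    p.isRandomVariable_W.prodMk ((IsRandomVariable.pi (p.isRandomVariable_Q v)).prodMk
      (IsRandomVariable.pi (p.isRandomVariable_A v)))
  have hlog := log_card_pos (F := F)
  have hdiv : ∀ {x y : ℝ}, x / Real.log (Fintype.card F) - y / Real.log (Fintype.card F) = 0 →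
      x = y := fun h => (div_left_inj' hlog.ne').1 (sub_eq_zero.1 h)
  have key := sum_fEntropy_answer_ge (G := G) (V := V) (τ := τ)
    (p := fun v t => p.P.real (T v ⁻¹' {t})) (w := fun t => t.1) (q := fun t => t.2.1)
    (a := fun t => t.2.2) (fun v t => measureReal_nonneg)
    (fun v => sum_measureReal_preimage (hT v)) ?_ ?_ ?_ ?_ ?_ hν hI hκ hB V.rank ∅
    (Finset.empty_subset _) (by simpa using hBcard) v
  · have e : ∀ j, entropy (Fintype.card F) p.P (p.A v j) * Real.log (Fintype.card F) =
        fEntropy (fun t => p.P.real (T v ⁻¹' {t})) (fun t => t.2.2 j) := by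
      intro j
      rw [← div_eq_iff hlog.ne' |>.1 (entropy_comp (P := p.P) (hT v) _ (fun t => t.2.2 j)).symm]
    have h0 : ∀ t, 0 ≤ p.P.real (T v ⁻¹' {t}) := fun t => measureReal_nonneg
    -- For `S = ∅` the recursion bounds the sum of `H(A_j | Q_j)`; dropping the conditioning gives
    -- `H(A_j)`.
    have e2 := Finset.sum_le_sum fun j (_ : j ∈ Finset.univ) =>
      fEntropy_submodular (p := fun t => p.P.real (T v ⁻¹' {t})) h0
        (J := fun t => (t.2.2 j, evaluationOn V ∅ t.1, t.2.1 j)) (M := fun _ => ())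
        (X := fun t => t.2.2 j) (Y := fun t => (evaluationOn V ∅ t.1, t.2.1 j))
        (by simp +contextual) (by simp) (by simp)
    rw [fEntropy_const (f := fun _ => ()) (sum_measureReal_preimage (hT v)) fun _ _ => rfl] at e2
    simp only [Finset.sum_add_distrib, add_zero, ← e,
      ← Finset.sum_mul] at e2
    rw [Finset.sum_sub_distrib] at key
    refine le_of_mul_le_mul_right ?_ hlog
    linarith
  · intro v x
    rw [← p.uniform x]
    refine Eq.trans ?_ (measureReal_preimage_comp (P := p.P) (hT v) (fun t => t.1) x).symm
    congr!
  · intro v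
    have h := p.independence v
    rw [mutualInfo, entropy_comp (P := p.P) (hT v) _ (fun t => (t.1, t.2.1)),
      entropy_comp (P := p.P) (hT v) _ (fun t => t.1),
      entropy_comp (P := p.P) (hT v) _ (fun t => t.2.1), ← add_div] at h
    exact (hdiv h).symm
  · intro v j
    have h := p.deterministic v j
    rw [condEntropy, entropy_comp (P := p.P) (hT v) _
        (fun t => (t.2.2 j, t.2.1 j, stored G t.1 j)),
      entropy_comp (P := p.P) (hT v) _ (fun t => (t.2.1 j, stored G t.1 j))] at h
    exact hdiv h
  · intro v
    have h := p.recovery v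
    rw [condEntropy, entropy_comp (P := p.P) (hT v) _
        (fun t => (evaluation V t.1 v, t.2.2, t.2.1)),
      entropy_comp (P := p.P) (hT v) _ (fun t => (t.2.2, t.2.1))] at h
    exact hdiv h
  · intro v v' j S
    rcases eq_or_ne v v' with rfl | hv
    · rfl
    let T' : Fin μ → p.Ω → p.Query × p.Answer j × (Fin μ → Fin p.β × Fin k → F) :=
      fun v ω => (p.Q v j ω, p.A v j ω, evaluation V (p.W ω))
    have hW : IsRandomVariable fun ω => evaluation V (p.W ω) :=
      p.isRandomVariable_W.comp _
    have hT' : ∀ v, IsRandomVariable (T' v) := fun v =>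
      (p.isRandomVariable_Q v j).prodMk ((p.isRandomVariable_A v j).prodMk hW)
    -- The entropies to be compared depend only on query `j`, answer `j` and the evaluations, and
    -- privacy equates the laws of exactly this triple.
    have tr : ∀ {σ : Type _} [Fintype σ] (g : τ → σ)
        (g' : p.Query × p.Answer j × (Fin μ → Fin p.β × Fin k → F) → σ),
        (∀ v ω, g (T v ω) = g' (T' v ω)) → ∀ v,
        fEntropy (fun t => p.P.real (T v ⁻¹' {t})) g =
          fEntropy (fun t => p.P.real (T' v ⁻¹' {t})) g' := by
      intro σ _ g g' hg v
      have h1 := entropy_comp (P := p.P) (hT v) (Fintype.card F) g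
      have h2 := entropy_comp (P := p.P) (hT' v) (Fintype.card F) g'
      simp only [hg] at h1
      exact (div_left_inj' hlog.ne').1 (h1.symm.trans h2)
    have hlaw : (fun t => p.P.real (T' v ⁻¹' {t})) = fun t => p.P.real (T' v' ⁻¹' {t}) :=
      funext (p.privacy v v' j hv)
    rw [tr (fun t => (t.2.2 j, evaluationOn V S t.1, t.2.1 j))
        (fun z => (z.2.1, fun s => z.2.2 s, z.1)) (fun _ _ => rfl),
      tr (fun t => (t.2.2 j, evaluationOn V S t.1, t.2.1 j))
        (fun z => (z.2.1, fun s => z.2.2 s, z.1)) (fun _ _ => rfl),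
      tr (fun t => (evaluationOn V S t.1, t.2.1 j))
        (fun z => (fun s => z.2.2 s, z.1)) (fun _ _ => rfl),
      tr (fun t => (evaluationOn V S t.1, t.2.1 j))
        (fun z => (fun s => z.2.2 s, z.1)) (fun _ _ => rfl), hlaw]

end Converse

section LogCard

variable {Ω : Type*} [MeasurableSpace Ω] {P : Measure Ω} [IsProbabilityMeasure P]
  {S : Type*} [Fintype S]

theorem entropy_le_log_card {Z : Ω → S} (hZ : IsRandomVariable Z) {q : ℕ} (hq : 1 < q) :
    entropy q P Z ≤ Real.log (Fintype.card S) / Real.log q := by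
  have hS : (0 : ℝ) < Fintype.card S := by
    obtain ⟨ω⟩ := P.nonempty_of_neZero
    exact_mod_cast Fintype.card_pos_iff.2 ⟨Z ω⟩
  have h1 := sum_measureReal_preimage (P := P) hZ
  have key : ∀ z : S, Real.negMulLog (P.real (Z ⁻¹' {z})) -
      P.real (Z ⁻¹' {z}) * Real.log (Fintype.card S) ≤
      1 / (Fintype.card S : ℝ) - P.real (Z ⁻¹' {z}) := by
    intro z
    rcases (measureReal_nonneg (μ := P) (s := Z ⁻¹' {z})).eq_or_lt with h | h
    · simp [← h]
    · have := mul_le_mul_of_nonneg_left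
        (Real.log_le_sub_one_of_pos (one_div_pos.2 (mul_pos h hS))) h.le
      rw [one_div, Real.log_inv, Real.log_mul h.ne' hS.ne', mul_sub, mul_inv,
        mul_inv_cancel_left₀ h.ne'] at this
      rw [Real.negMulLog, one_div]
      linarith
  have hsum := Finset.sum_le_sum fun z (_ : z ∈ Finset.univ) => key z
  simp only [Finset.sum_sub_distrib, ← Finset.sum_mul, h1, Finset.sum_const, Finset.card_univ,
    nsmul_eq_mul] at hsum
  rw [mul_one_div_cancel hS.ne'] at hsum
  rw [entropy, ← Finset.sum_div]
  refine div_le_div_of_nonneg_right (by linarith) (Real.log_nonneg ?_)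
  exact_mod_cast hq.le

end LogCard

/-! ### Rates and download costs -/

namespace PLCProtocol

variable {F : Type*} [Field F] [Fintype F] {k n f μ : ℕ} {G : Matrix (Fin k) (Fin n) F}
  {V : Matrix (Fin μ) (Fin f) F} (p : PLCProtocol G V)

theorem entropy_evaluation_symbol {v : Fin μ} (hv : V v ≠ 0) (l : Fin p.β × Fin k) :
    entropy (Fintype.card F) p.P (fun ω => evaluation V (p.W ω) v l) = 1 := by
  classical
  rw [entropy_comp (P := p.P) p.isRandomVariable_W _ fun w => evaluation V w v l]
  let φ : Messages F f p.β k →+ F := AddMonoidHom.mk' (fun w => evaluation V w v l) fun w w' => by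
    simp [evaluation_apply, mul_add, Finset.sum_add_distrib]
  have hφ : Function.Surjective φ := by
    intro y
    obtain ⟨m, hm⟩ := Function.ne_iff.1 hv
    refine ⟨Pi.single m fun _ _ => y / V v m, ?_⟩
    change evaluation V _ v l = y
    rw [evaluation_apply, Finset.sum_eq_single m]
    · rw [Pi.single_eq_same, mul_div_cancel₀ _ hm]
    · intro b _ hb
      rw [Pi.single_eq_of_ne hb]
      simp
    · simp
  have h := fEntropy_of_surjective (w := fun w : Messages F f p.β k => w)
    (sum_measureReal_preimage (P := p.P) p.isRandomVariable_W)
    (fun x => (Finset.sum_eq_single x (by simp +contextual) (by simp)).trans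
      (by simpa using p.uniform x)) φ hφ
  change fEntropy _ (fun w => evaluation V w v l) = _ at h
  rw [h]
  exact div_self log_card_pos.ne'

theorem minEntropy_eq_one (hk : 0 < k) (hμ : 0 < μ) (hV : ∀ v, V v ≠ 0) : p.minEntropy = 1 := by
  have : Nonempty (Fin μ × (Fin p.β × Fin k)) := ⟨⟨0, hμ⟩, ⟨0, p.β_pos⟩, ⟨0, hk⟩⟩
  rw [minEntropy]
  simp only [p.entropy_evaluation_symbol (hV _)]
  exact ciInf_const

theorem sum_entropy_le_downloadEntropy (v : Fin μ) :
    ∑ j : Fin n, entropy (Fintype.card F) p.P (p.A v j) ≤ p.downloadEntropy :=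
  le_ciSup (f := fun v => ∑ j : Fin n, entropy (Fintype.card F) p.P (p.A v j))
    (Set.finite_range _).bddAbove v

theorem downloadEntropy_le_downloadLength (hμ : 0 < μ) : p.downloadEntropy ≤ p.downloadLength := by
  have : Nonempty (Fin μ) := ⟨⟨0, hμ⟩⟩
  exact ciSup_le fun v => Finset.sum_le_sum fun j _ =>
    entropy_le_log_card (p.isRandomVariable_A v j) Fintype.one_lt_card

end PLCProtocol

/-- The claimed capacity is attained as soon as some protocol has the right number of downloaded
symbols. -/
theorem isPLCCapacity_of_exists {F : Type*} [Field F] [Fintype F] {n k f μ : ℕ}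
    (hk : 0 < k) (hkn : k < n) (hμ : 0 < μ) {G : Matrix (Fin k) (Fin n) F}
    {V : Matrix (Fin μ) (Fin f) F} (hV : ∀ v : Fin μ, V v ≠ 0) {κ ν : ℕ}
    {I : Fin ν → Finset (Fin n)} (hν : 0 < ν) (hκν : κ * n = k * ν)
    (hI : ∀ u, IsInformationSet G (I u))
    (hκ : ∀ j, (Finset.univ.filter fun u => j ∈ I u).card = κ) (p : PLCProtocol G V)
    (hp : p.downloadLength =
      ((p.β * k : ℕ) : ℝ) * ∑ t ∈ Finset.range V.rank, ((k : ℝ) / n) ^ t) :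
    IsPLCCapacity G V ((1 - (k : ℝ) / n) * (1 - ((k : ℝ) / n) ^ V.rank)⁻¹) := by
  have hn0 : (0 : ℝ) < n := by exact_mod_cast hk.trans hkn
  have hk0 : (0 : ℝ) < k := by exact_mod_cast hk
  have hν0 : (0 : ℝ) < ν := by exact_mod_cast hν
  set ρ : ℝ := (k : ℝ) / n with hρ
  have hρ1 : ρ < 1 := (div_lt_one hn0).2 (by exact_mod_cast hkn)
  have hρ0 : 0 < ρ := div_pos hk0 hn0
  have hρκ : (κ : ℝ) / ν = ρ := by
    rw [hρ, div_eq_div_iff hν0.ne' hn0.ne']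
    exact_mod_cast hκν
  have hr : 0 < V.rank := by
    rw [Nat.pos_iff_ne_zero, Ne, Matrix.rank_eq_finrank_span_row, Submodule.finrank_eq_zero,
      Submodule.span_eq_bot]
    exact fun h => hV ⟨0, hμ⟩ (h _ ⟨_, rfl⟩)
  set σ := ∑ t ∈ Finset.range V.rank, ρ ^ t with hσ
  have hσ0 : 0 < σ := Finset.sum_pos (fun t _ => pow_pos hρ0 t) (by simpa using hr.ne')
  have hc : (1 - ρ) * (1 - ρ ^ V.rank)⁻¹ = σ⁻¹ := by
    have h1 : 1 - ρ ^ V.rank = (1 - ρ) * σ := (mul_neg_geom_sum ρ V.rank).symm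
    rw [h1, mul_inv, ← mul_assoc, mul_inv_cancel₀ (sub_pos.2 hρ1).ne', one_mul]
  rw [hc]
  have hL : ∀ p : PLCProtocol G V, (0 : ℝ) < ((p.β * k : ℕ) : ℝ) := fun p => by
    exact_mod_cast Nat.mul_pos p.β_pos hk
  have hlow : ∀ p : PLCProtocol G V, ((p.β * k : ℕ) : ℝ) * σ ≤ p.downloadEntropy := fun p => by
    have := p.sum_entropy_answer_ge ⟨0, hμ⟩ hν hI hκ
    rw [hρκ] at this
    exact this.trans (p.sum_entropy_le_downloadEntropy _)
  have hbound : ∀ (p : PLCProtocol G V) (D : ℝ), ((p.β * k : ℕ) : ℝ) * σ ≤ D →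
      ((p.β * k : ℕ) : ℝ) * p.minEntropy / D ≤ σ⁻¹ := fun p D hD => by
    have hD0 : 0 < D := (mul_pos (hL p) hσ0).trans_le hD
    rw [p.minEntropy_eq_one hk hμ hV, mul_one, div_le_iff₀ hD0, ← div_eq_inv_mul,
      le_div_iff₀ hσ0]
    exact hD
  have hattain : ((p.β * k : ℕ) : ℝ) * p.minEntropy / (((p.β * k : ℕ) : ℝ) * σ) = σ⁻¹ := by
    rw [p.minEntropy_eq_one hk hμ hV, mul_one, div_mul_eq_div_div, div_self (hL p).ne', one_div]
  -- The download entropy lies between the converse bound and the download length, so a single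
  -- protocol attains both maxima.
  have hDe : p.downloadEntropy = ((p.β * k : ℕ) : ℝ) * σ :=
    le_antisymm ((p.downloadEntropy_le_downloadLength hμ).trans hp.le) (hlow p)
  refine ⟨⟨⟨p, ?_⟩, ?_⟩, ⟨⟨p, ?_⟩, ?_⟩⟩
  · simp only [PLCProtocol.rate, hDe, hattain]
  · rintro _ ⟨p, rfl⟩
    exact hbound p _ (hlow p)
  · simp only [PLCProtocol.symbolRate, hp, hattain]
  · rintro _ ⟨p, rfl⟩
    exact hbound p _ ((hlow p).trans (p.downloadEntropy_le_downloadLength hμ))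

/-! ### Exterior powers of the kernel of a linear form -/

section Contraction

variable {F R : Type*} [Field F] [AddCommGroup R] [Module F R]

/-- Contraction of the exterior algebra by a linear form. -/
noncomputable def contract (ε : Module.Dual F R) : ExteriorAlgebra F R →ₗ[F] ExteriorAlgebra F R :=
  CliffordAlgebra.contractLeft (Q := (0 : QuadraticForm F R)) ε

theorem contract_ι_mul (ε : Module.Dual F R) (e : R) (x : ExteriorAlgebra F R) :
    contract ε (ExteriorAlgebra.ι F e * x) = ε e • x - ExteriorAlgebra.ι F e * contract ε x :=
  CliffordAlgebra.contractLeft_ι_mul ε e x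

theorem contract_contract (ε : Module.Dual F R) (x : ExteriorAlgebra F R) :
    contract ε (contract ε x) = 0 :=
  CliffordAlgebra.contractLeft_contractLeft ε x

theorem ι_mul_mem {d : ℕ} (e : R) {x : ExteriorAlgebra F R} (hx : x ∈ ⋀[F]^d R) :
    ExteriorAlgebra.ι F e * x ∈ ⋀[F]^(d + 1) R := by
  rw [ExteriorAlgebra.exteriorPower, pow_succ']
  exact Submodule.mul_mem_mul ⟨e, rfl⟩ hx

/-- Degree zero and positive degrees are treated together, since contracting a product with a vector
leaves the contraction of a factor of one degree less, which may be zero. -/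
theorem contract_mem_aux (ε : Module.Dual F R) {d : ℕ} {x : ExteriorAlgebra F R}
    (hx : x ∈ ⋀[F]^d R) :
    (d = 0 → contract ε x = 0) ∧ ∀ d', d = d' + 1 → contract ε x ∈ ⋀[F]^d' R := by
  induction hx using Submodule.pow_induction_on_left' with
  | algebraMap c =>
    exact ⟨fun _ => CliffordAlgebra.contractLeft_algebraMap (Q := 0) ε c, fun d' h => by omega⟩
  | add x y i hx hy ihx ihy =>
    refine ⟨fun h => by rw [map_add, ihx.1 h, ihy.1 h, add_zero], fun d' h => ?_⟩
    rw [map_add]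
    exact add_mem (ihx.2 d' h) (ihy.2 d' h)
  | mem_mul m hm i x hx ih =>
    obtain ⟨e, rfl⟩ := hm
    refine ⟨fun h => by omega, fun d' h => ?_⟩
    obtain rfl : i = d' := by omega
    rw [contract_ι_mul]
    refine sub_mem (Submodule.smul_mem _ _ hx) ?_
    rcases i with _ | i
    · rw [ih.1 rfl, mul_zero]
      exact zero_mem _
    · exact ι_mul_mem e (ih.2 i rfl)

theorem contract_mem (ε : Module.Dual F R) {d : ℕ} {x : ExteriorAlgebra F R}
    (hx : x ∈ ⋀[F]^(d + 1) R) : contract ε x ∈ ⋀[F]^d R :=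
  (contract_mem_aux ε hx).2 d rfl

/-- The elements of degree `d` of the exterior algebra of the kernel of `ε`, described as the
elements of degree `d` that are annihilated by the contraction by `ε`. -/
noncomputable def kerPower (ε : Module.Dual F R) (d : ℕ) : Submodule F (ExteriorAlgebra F R) :=
  LinearMap.ker (contract ε) ⊓ ⋀[F]^d R

theorem mem_kerPower {ε : Module.Dual F R} {d : ℕ} {x : ExteriorAlgebra F R} :
    x ∈ kerPower ε d ↔ contract ε x = 0 ∧ x ∈ ⋀[F]^d R := Iff.rfl

theorem contract_ι_mul_of_mem {ε : Module.Dual F R} {e : R} (he : ε e = 1)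
    {x : ExteriorAlgebra F R} (hx : contract ε x = 0) :
    contract ε (ExteriorAlgebra.ι F e * x) = x := by
  rw [contract_ι_mul, he, hx, mul_zero, sub_zero, one_smul]

instance [Module.Finite F R] (ε : Module.Dual F R) (d : ℕ) : Module.Finite F (kerPower ε d) :=
  Submodule.finiteDimensional_of_le (inf_le_right : kerPower ε d ≤ ⋀[F]^d R)

/-- Contraction maps `Λ^(d+1) R` onto `kerPower ε d`, with left multiplication by `e` as a section,
and its kernel is `kerPower ε (d + 1)`. The dimensions then follow from Pascal's rule. -/
theorem finrank_kerPower [Module.Finite F R] {ε : Module.Dual F R} {e : R} (he : ε e = 1) {r : ℕ}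
    (hr : Module.finrank F R = r + 1) (d : ℕ) :
    Module.finrank F (kerPower ε d) = r.choose d := by
  induction d with
  | zero =>
    have : kerPower ε 0 = ⋀[F]^0 R :=
      le_antisymm inf_le_right fun x hx => ⟨(contract_mem_aux ε hx).1 rfl, hx⟩
    rw [this, exteriorPower.finrank_eq, Nat.choose_zero_right, Nat.choose_zero_right]
  | succ d ih =>
    let c : ⋀[F]^(d + 1) R →ₗ[F] kerPower ε d :=
      LinearMap.codRestrict _ ((contract ε).domRestrict _) fun x =>
        ⟨contract_contract ε _, contract_mem ε x.2⟩
    have hsurj : LinearMap.range c = ⊤ := LinearMap.range_eq_top.2 fun y =>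
      ⟨⟨ExteriorAlgebra.ι F e * y, ι_mul_mem e y.2.2⟩,
        Subtype.ext (contract_ι_mul_of_mem he y.2.1)⟩
    have hker : (LinearMap.ker c).map (⋀[F]^(d + 1) R).subtype = kerPower ε (d + 1) := by
      ext x
      simp only [Submodule.mem_map, LinearMap.mem_ker, Submodule.subtype_apply, mem_kerPower]
      constructor
      · rintro ⟨y, hy, rfl⟩
        exact ⟨congrArg Subtype.val hy, y.2⟩
      · rintro ⟨h0, hx⟩
        exact ⟨⟨x, hx⟩, Subtype.ext h0, rfl⟩
    have h := LinearMap.finrank_range_add_finrank_ker c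
    rw [hsurj, finrank_top, ih, exteriorPower.finrank_eq, hr, Nat.choose_succ_succ',
      ← Submodule.finrank_map_subtype_eq, hker] at h
    omega

end Contraction

/-! ### Combinatorics of the queries -/

section Patterns

/-- A combinatorial pattern of queries, for databases with index in `Fin n` and information sets
`I u`. The symbols that are requested are indexed by `Fin ν × Symbol`, and `(u, s)` is requested
from the databases in `I u`; every database receives queries with index in `Query`. In the query
`m` to database `j` the symbol `own j m` is masked by the known interference `side j m`. -/
structure QueryPattern {n ν : ℕ} (I : Fin ν → Finset (Fin n)) (r : ℕ) where
  /-- The index type of the symbols. -/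
  Symbol : Type
  /-- The index type of the queries. -/
  Query : Type
  [fintypeSymbol : Fintype Symbol]
  [fintypeQuery : Fintype Query]
  /-- The degree of a symbol. -/
  degSymbol : Symbol → ℕ
  /-- The degree of a query. -/
  degQuery : Query → ℕ
  /-- The desired symbol in a query. -/
  own : Fin n → Query → Fin ν × Symbol
  /-- The side information used for a query. -/
  side : Fin n → Query → Option (Fin ν × Symbol)
  degSymbol_le : ∀ s, degSymbol s ≤ r
  deg_own : ∀ j m, degSymbol (own j m).2 = degQuery m
  deg_side : ∀ j m x, side j m = some x → degSymbol x.2 + 1 = degQuery m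
  exists_own : ∀ j u s, j ∈ I u → ∃ m, own j m = (u, s)
  exists_side : ∀ j u s, j ∉ I u → degSymbol s < r → ∃ m, side j m = some (u, s)

attribute [instance] QueryPattern.fintypeSymbol QueryPattern.fintypeQuery

/-- The three binomial sums give, in this order, the dimensions of the query space, of the symbol
space (where the kernel has one dimension less than `R`) and of the answer space. -/
theorem sum_pow_mul_choose (κ δ r : ℕ) :
    ∑ d : Fin (r + 1), κ ^ (r - d) * δ ^ (d : ℕ) * r.choose d = (κ + δ) ^ r := by
  rw [Fin.sum_univ_eq_sum_range (fun d => κ ^ (r - d) * δ ^ d * r.choose d), add_comm κ, add_pow]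
  exact Finset.sum_congr rfl fun d _ => by rw [Nat.cast_id]; ring

theorem sum_pow_mul_choose_pred (κ δ r : ℕ) :
    ∑ d : Fin (r + 1 + 1), κ ^ (r + 1 - d) * δ ^ (d : ℕ) * r.choose d = κ * (κ + δ) ^ r := by
  rw [Fin.sum_univ_castSucc, ← sum_pow_mul_choose, Finset.mul_sum]
  simp only [Fin.val_castSucc, Fin.val_last, Nat.choose_succ_self, mul_zero, add_zero]
  refine Finset.sum_congr rfl fun d _ => ?_
  rw [Nat.succ_sub (Nat.le_of_lt_succ d.2), pow_succ]
  ring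

theorem sum_pow_mul_choose_succ (κ δ r : ℕ) :
    δ * ∑ d : Fin (r + 1), κ ^ (r - d) * δ ^ (d : ℕ) * r.choose (d + 1) + κ * κ ^ r =
      κ * (κ + δ) ^ r := by
  rw [Fin.sum_univ_castSucc, ← sum_pow_mul_choose, Fin.sum_univ_succ, mul_add, mul_add,
    Finset.mul_sum, Finset.mul_sum]
  simp only [Fin.val_castSucc, Fin.val_last, Nat.choose_succ_self, mul_zero, add_zero, Fin.val_succ,
    Fin.val_zero, pow_zero, mul_one, Nat.choose_zero_right, Nat.sub_zero]
  rw [add_comm]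
  congr 1
  refine Finset.sum_congr rfl fun d _ => ?_
  rw [show r - (d : ℕ) = r - (d + 1) + 1 by have := d.2; omega, pow_succ, pow_succ]
  ring

/-- With `N d = κ^(r-d) δ^d` symbols of degree `d` per information set, a database is asked for `κ N
d` of them and has `δ N d` others as possible side information. Since `δ N d = κ N (d+1)`, the
latter match its queries of degree `d + 1` one to one. -/
theorem exists_queryPattern {n κ δ : ℕ} {I : Fin (κ + δ) → Finset (Fin n)}
    (hκ : ∀ j, (Finset.univ.filter fun u => j ∈ I u).card = κ) (r : ℕ) :
    ∃ A : QueryPattern I r, ∀ c : ℕ → ℕ,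
      ∑ s, c (A.degSymbol s) = ∑ d : Fin (r + 1), κ ^ (r - d) * δ ^ (d : ℕ) * c d ∧
      ∑ m, c (A.degQuery m) = κ * ∑ d : Fin (r + 1), κ ^ (r - d) * δ ^ (d : ℕ) * c d := by
  let N : ℕ → ℕ := fun d => κ ^ (r - d) * δ ^ d
  have hδ : ∀ j, (Finset.univ.filter fun u => j ∉ I u).card = δ := fun j => by
    have := Finset.card_filter_add_card_filter_not (s := Finset.univ) (fun u => j ∈ I u)
    rw [hκ, Finset.card_univ, Fintype.card_fin] at this
    omega
  have hown : ∀ j d, Nonempty (Fin (κ * N d) ≃ {u // j ∈ I u} × Fin (N d)) := fun j d =>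
    ⟨Fintype.equivOfCardEq (by
      rw [Fintype.card_prod, Fintype.card_fin, Fintype.card_fin, Fintype.card_subtype, hκ])⟩
  have hside : ∀ j d, Nonempty (d < r → (Fin (κ * N (d + 1)) ≃ {u // j ∉ I u} × Fin (N d))) :=
    fun j d => ⟨fun h => Fintype.equivOfCardEq (by
      rw [Fintype.card_prod, Fintype.card_fin, Fintype.card_fin, Fintype.card_subtype, hδ]
      simp only [N]
      rw [show r - d = r - (d + 1) + 1 by omega, pow_succ, pow_succ]
      ring)⟩
  let own := fun j d => (hown j d).some
  let side := fun j d => (hside j d).some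
  refine ⟨{
    Symbol := Σ d : Fin (r + 1), Fin (N d)
    Query := Σ d : Fin (r + 1), Fin (κ * N d)
    degSymbol := fun s => s.1
    degQuery := fun m => m.1
    own := fun j m => ((own j m.1 m.2).1, ⟨m.1, (own j m.1 m.2).2⟩)
    side := fun j m => match m with
      -- Queries of degree zero are unmasked, as there are no symbols of degree `-1`.
      | ⟨⟨0, _⟩, _⟩ => none
      | ⟨⟨d + 1, h⟩, i⟩ => some ((side j d (by omega) i).1, ⟨⟨d, by omega⟩, (side j d (by omega) i).2⟩)
    degSymbol_le := fun s => Nat.le_of_lt_succ s.1.2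
    deg_own := fun j m => rfl
    deg_side := ?_
    exists_own := ?_
    exists_side := ?_ }, fun c => ⟨?_, ?_⟩⟩
  · rintro j ⟨⟨_ | d, h⟩, i⟩ x hx
    · simp at hx
    · simp only [Option.some.injEq] at hx
      simp [← hx]
  · rintro j u ⟨d, s⟩ hu
    exact ⟨⟨d, (own j d).symm (⟨u, hu⟩, s)⟩, by simp⟩
  · rintro j u ⟨⟨d, hd⟩, s⟩ hu hdr
    exact ⟨⟨⟨d + 1, by simpa using hdr⟩, (side j d hdr).symm (⟨u, hu⟩, s)⟩, by simp⟩
  · rw [Fintype.sum_sigma]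
    simp [N]
  · rw [Fintype.sum_sigma]
    simp [N, Finset.mul_sum, mul_assoc]

end Patterns

/-! ### The linear scheme in the exterior algebra -/

section Scheme

variable {F R : Type*} [Field F] [AddCommGroup R] [Module F R] {n ν r k β : ℕ}
  {I : Fin ν → Finset (Fin n)} (A : QueryPattern I r) {ε : Module.Dual F R} {e : R}

/-- The symbols that are requested, when the desired function is `ε`: every symbol of degree `d` is
an element of degree `d` in the exterior algebra of the kernel of `ε`. -/
abbrev SymbolSpace (ε : Module.Dual F R) : Type _ :=
  ∀ x : Fin ν × A.Symbol, kerPower ε (A.degSymbol x.2)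

/-- The values of the query functions of one database. -/
abbrev QuerySpace (F R : Type*) [Field F] [AddCommGroup R] [Module F R] : Type _ :=
  ∀ m : A.Query, ⋀[F]^(A.degQuery m) R

/-- The answers of one database. -/
abbrev AnswerSpace (F R : Type*) [Field F] [AddCommGroup R] [Module F R] : Type _ :=
  ∀ m : A.Query, ⋀[F]^(A.degQuery m + 1) R

/-- The side information that is used for the query `m` to database `j`. -/
def sideValue (ω : SymbolSpace A ε) (j : Fin n) (m : A.Query) : ExteriorAlgebra F R :=
  (A.side j m).elim 0 fun x => (ω x : ExteriorAlgebra F R)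

theorem contract_sideValue (ω : SymbolSpace A ε) (j : Fin n) (m : A.Query) :
    contract ε (sideValue A ω j m) = 0 := by
  unfold sideValue
  cases A.side j m with
  | none => exact map_zero _
  | some x => exact (ω x).2.1

theorem ι_mul_sideValue_mem (e : R) (ω : SymbolSpace A ε) (j : Fin n) (m : A.Query) :
    ExteriorAlgebra.ι F e * sideValue A ω j m ∈ ⋀[F]^(A.degQuery m) R := by
  unfold sideValue
  cases h : A.side j m with
  | none => rw [Option.elim_none, mul_zero]; exact zero_mem _
  | some x =>
    rw [← A.deg_side j m x h]
    exact ι_mul_mem e (ω x).2.2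

theorem own_mem (ω : SymbolSpace A ε) (j : Fin n) (m : A.Query) :
    (ω (A.own j m) : ExteriorAlgebra F R) ∈ ⋀[F]^(A.degQuery m) R := by
  rw [← A.deg_own j m]
  exact (ω (A.own j m)).2.2

/-- The query functions for database `j`: every desired symbol is masked with side information. -/
noncomputable def maskedQuery (ε : Module.Dual F R) (e : R) (j : Fin n) :
    SymbolSpace A ε →ₗ[F] QuerySpace A F R where
  toFun ω m := ⟨ω (A.own j m) + ExteriorAlgebra.ι F e * sideValue A ω j m,
    add_mem (own_mem A ω j m) (ι_mul_sideValue_mem A e ω j m)⟩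
  map_add' ω ω' := by
    funext m
    apply Subtype.ext
    simp only [sideValue, Pi.add_apply, Submodule.coe_add]
    cases A.side j m <;> simp [mul_add]
    abel
  map_smul' c ω := by
    funext m
    apply Subtype.ext
    simp only [sideValue, Pi.smul_apply, Submodule.coe_smul, RingHom.id_apply]
    cases A.side j m <;> simp

theorem maskedQuery_apply (ω : SymbolSpace A ε) (j : Fin n) (m : A.Query) :
    (maskedQuery A ε e j ω m : ExteriorAlgebra F R) =
      ω (A.own j m) + ExteriorAlgebra.ι F e * sideValue A ω j m := rfl

variable [Module.Finite F R]

/-- The kernel of `ε` has dimension `r - 1`, so its `r`-th exterior power vanishes. Hence symbols of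
top degree need not serve as side information. -/
theorem eq_zero_of_degSymbol_eq (he : ε e = 1) (hr : Module.finrank F R = r) {d : ℕ} (hd : d = r)
    (x : kerPower ε d) : x = 0 := by
  have hpos : 0 < Module.finrank F R := by
    have : Nontrivial R := ⟨e, 0, by rintro rfl; simp at he⟩
    exact Module.finrank_pos
  obtain ⟨r', rfl⟩ : ∃ r', r = r' + 1 := ⟨r - 1, by omega⟩
  have := finrank_kerPower he hr d
  rw [hd, Nat.choose_succ_self, Module.finrank_zero_iff] at this
  subst hd
  exact Subsingleton.elim _ _

/-- Contraction by `ε` separates `ω` from `e ∧ ω'`. Each symbol of degree below `r` occurs at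
database `j` either as desired symbol or as side information, depending on whether `j ∈ I u`. -/
theorem maskedQuery_injective (he : ε e = 1) (hr : Module.finrank F R = r) (j : Fin n) :
    Function.Injective (maskedQuery A ε e j) := by
  rw [← LinearMap.ker_eq_bot, LinearMap.ker_eq_bot']
  intro ω hω
  have h0 : ∀ m, (ω (A.own j m) : ExteriorAlgebra F R) +
      ExteriorAlgebra.ι F e * sideValue A ω j m = 0 := fun m => by
    rw [← maskedQuery_apply, hω]; rfl
  have hside : ∀ m, sideValue A ω j m = 0 := fun m => by
    have := congrArg (contract ε) (h0 m)
    rwa [map_add, (ω _).2.1, contract_ι_mul_of_mem he (contract_sideValue A ω j m), zero_add,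
      map_zero] at this
  have hown : ∀ m, (ω (A.own j m) : ExteriorAlgebra F R) = 0 := fun m => by
    have := h0 m
    rwa [hside, mul_zero, add_zero] at this
  funext ⟨u, s⟩
  by_cases hu : j ∈ I u
  · obtain ⟨m, hm⟩ := A.exists_own j u s hu
    have := hown m
    rw [hm] at this
    exact Subtype.ext this
  · rcases (A.degSymbol_le s).eq_or_lt with hs | hs
    · exact eq_zero_of_degSymbol_eq he hr hs _
    · obtain ⟨m, hm⟩ := A.exists_side j u s hu hs
      have := hside m
      rw [sideValue, hm] at this
      exact Subtype.ext this

/-- `maskedQuery` as an equivalence. -/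
noncomputable def maskedQueryEquiv (he : ε e = 1) (hr : Module.finrank F R = r)
    (hdim : Module.finrank F (SymbolSpace A ε) = Module.finrank F (QuerySpace A F R)) (j : Fin n) :
    SymbolSpace A ε ≃ₗ[F] QuerySpace A F R :=
  LinearEquiv.ofInjectiveOfFinrankEq (maskedQuery A ε e j) (maskedQuery_injective A he hr j) hdim

omit [Module.Finite F R]

/-- The answer of a database with content `y` to the query `p`. -/
noncomputable def answer (p : (Fin β → F) → QuerySpace A F R) (y : Fin β → R) : AnswerSpace A F R :=
  fun m => ⟨∑ i, ExteriorAlgebra.ι F (y i) * (p (Pi.single i 1) m : ExteriorAlgebra F R),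
    sum_mem fun i _ => ι_mul_mem (y i) (p (Pi.single i 1) m).2⟩

theorem answer_apply (p : (Fin β → F) → QuerySpace A F R) (y : Fin β → R) (m : A.Query) :
    (answer A p y m : ExteriorAlgebra F R) =
      ∑ i, ExteriorAlgebra.ι F (y i) * (p (Pi.single i 1) m : ExteriorAlgebra F R) := rfl

theorem answer_sub (p : (Fin β → F) → QuerySpace A F R) (y y' : Fin β → R) :
    answer A p (y - y') = answer A p y - answer A p y' := by
  funext m
  apply Subtype.ext
  simp [answer_apply, sub_mul, Finset.sum_sub_distrib]

/-- Split `x = ε(x) e + x'` and use `e ∧ e = 0` and `x' ∧ e = -e ∧ x'`. If `ε e = 1` and `ω`, `ω'`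
come from the kernel, this sorts the answer into its `e`-part and its `K`-part. -/
theorem ι_mul_masked (e x : R) (ω ω' : ExteriorAlgebra F R) :
    ExteriorAlgebra.ι F x * (ω + ExteriorAlgebra.ι F e * ω') =
      ExteriorAlgebra.ι F e * (ε x • ω) + ExteriorAlgebra.ι F (x - ε x • e) * ω -
        ExteriorAlgebra.ι F e * (ExteriorAlgebra.ι F (x - ε x • e) * ω') := by
  have h1 := ExteriorAlgebra.ι_add_mul_swap (R := F) x e
  have h2 := ExteriorAlgebra.ι_sq_zero (R := F) e
  have h3 : ExteriorAlgebra.ι F x * ExteriorAlgebra.ι F e =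
      -(ExteriorAlgebra.ι F e * ExteriorAlgebra.ι F x) := eq_neg_of_add_eq_zero_left h1
  simp only [map_sub, map_smul, mul_add, sub_mul, mul_sub, smul_mul_assoc, mul_smul_comm,
    ← mul_assoc, h2, h3, neg_mul, zero_mul, smul_zero]
  abel

/-- The values of the desired function can be recovered from the answers. -/
theorem recover_of_answer_eq_zero {G : Matrix (Fin k) (Fin n) F} (hI : ∀ u, IsInformationSet G (I u))
    (he : ε e = 1) (g : (Fin β → F) →ₗ[F] SymbolSpace A ε)
    (hg : Function.Injective g) (X : Fin β → Fin k → R)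
    (h : ∀ j, answer A (fun x => maskedQuery A ε e j (g x)) (fun i => ∑ a, G a j • X i a) = 0)
    (i : Fin β) (a : Fin k) : ε (X i a) = 0 := by
  let ω : Fin β → SymbolSpace A ε := fun i => g (Pi.single i 1)
  let Y : Fin β → Fin k → R := fun i a => X i a - ε (X i a) • e
  have hY : ∀ i a, ε (Y i a) = 0 := fun i a => by simp [Y, he]
  -- `T` is the desired payload, `Z` the interference it comes with, and `Z'` the interference of
  -- the side information. By linearity decoding amounts to showing that `Z`, then `Z'`, then `T`
  -- vanish when all answers do.
  let T : Fin ν × A.Symbol → Fin k → ExteriorAlgebra F R := fun x a =>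
    ∑ i, ε (X i a) • (ω i x : ExteriorAlgebra F R)
  let Z : Fin ν × A.Symbol → Fin k → ExteriorAlgebra F R := fun x a =>
    ∑ i, ExteriorAlgebra.ι F (Y i a) * (ω i x : ExteriorAlgebra F R)
  let Z' : Fin n → A.Query → Fin k → ExteriorAlgebra F R := fun j m a =>
    ∑ i, ExteriorAlgebra.ι F (Y i a) * sideValue A (ω i) j m
  have hcι : ∀ i a (z : ExteriorAlgebra F R), contract ε z = 0 →
      contract ε (ExteriorAlgebra.ι F (Y i a) * z) = 0 := fun i a z hz => by
    rw [contract_ι_mul, hY, hz, mul_zero, zero_smul, sub_zero]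
  have hT : ∀ x a, contract ε (T x a) = 0 := fun x a => by
    rw [map_sum]
    exact Finset.sum_eq_zero fun i _ => by
      rw [map_smul, LinearMap.mem_ker.1 (ω i x).2.1, smul_zero]
  have hZ : ∀ x a, contract ε (Z x a) = 0 := fun x a => by
    rw [map_sum]
    exact Finset.sum_eq_zero fun i _ => hcι i a _ (ω i x).2.1
  have hZ' : ∀ j m a, contract ε (Z' j m a) = 0 := fun j m a => by
    rw [map_sum]
    exact Finset.sum_eq_zero fun i _ => hcι i a _ (contract_sideValue A (ω i) j m)
  have main : ∀ j m, ExteriorAlgebra.ι F e * (∑ a, G a j • (T (A.own j m) a - Z' j m a)) +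
      ∑ a, G a j • Z (A.own j m) a = 0 := by
    intro j m
    have := congrArg (fun y : AnswerSpace A F R => (y m : ExteriorAlgebra F R)) (h j)
    rw [answer_apply] at this
    refine Eq.trans ?_ this
    simp only [maskedQuery_apply]
    rw [Finset.mul_sum, ← Finset.sum_add_distrib]
    simp only [map_sum, map_smul, Finset.sum_mul, smul_mul_assoc, ι_mul_masked (ε := ε)]
    rw [Finset.sum_comm]
    refine Finset.sum_congr rfl fun a _ => ?_
    rw [← Finset.smul_sum, mul_smul_comm, ← smul_add]
    congr 1
    simp only [T, Z, Z', Finset.sum_add_distrib, Finset.sum_sub_distrib, mul_sub, Finset.mul_sum]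
    abel
  -- Contraction annihilates the `K`-part and strips the factor `e`, so the two parts of the answer
  -- vanish separately.
  have mainT : ∀ j m, ∑ a, G a j • (T (A.own j m) a - Z' j m a) = 0 := by
    intro j m
    have h0 : contract ε (∑ a, G a j • (T (A.own j m) a - Z' j m a)) = 0 := by
      simp only [map_sum, map_smul, map_sub, hT, hZ', sub_zero, smul_zero, Finset.sum_const_zero]
    have h1 := congrArg (contract ε) (main j m)
    rw [map_add, contract_ι_mul_of_mem he h0, map_zero] at h1
    simpa only [map_sum, map_smul, hZ, smul_zero, Finset.sum_const_zero, add_zero] using h1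
  have mainZ : ∀ j m, ∑ a, G a j • Z (A.own j m) a = 0 := by
    intro j m
    have := main j m
    rwa [mainT, mul_zero, zero_add] at this
  have hZ0 : ∀ x, Z x = 0 := by
    rintro ⟨u, s⟩
    refine (hI u).eq_zero fun j hj => ?_
    obtain ⟨m, hm⟩ := A.exists_own j u s hj
    rw [← hm]
    exact mainZ j m
  -- The side information is a symbol requested elsewhere, whose interference has already been
  -- decoded from its own information set.
  have hZ0' : ∀ j m a, Z' j m a = 0 := by
    intro j m a
    simp only [Z', sideValue]
    cases A.side j m with
    | none => simp
    | some x => exact congrFun (hZ0 x) a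
  have hT0 : ∀ x, T x = 0 := by
    rintro ⟨u, s⟩
    refine (hI u).eq_zero fun j hj => ?_
    obtain ⟨m, hm⟩ := A.exists_own j u s hj
    rw [← hm]
    simpa only [hZ0', sub_zero] using mainT j m
  have hgX : g (fun i => ε (X i a)) = 0 := by
    funext x
    apply Subtype.ext
    have := congrFun (hT0 x) a
    rw [pi_eq_sum_univ' (fun i => ε (X i a)), map_sum]
    simp only [map_smul, Finset.sum_apply, Pi.smul_apply]
    simpa [T, ω] using this
  exact congrFun (hg (hgX.trans (map_zero g).symm)) i

end Scheme

/-! ### Protocols from randomized linear schemes -/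

section UniformSpace

/-- The uniform probability measure on `Fin N`. -/
noncomputable def uniformFin (N : ℕ) [NeZero N] : @Measure (Fin N) ⊤ :=
  letI : MeasurableSpace (Fin N) := ⊤
  (PMF.uniformOfFintype (Fin N)).toMeasure

variable {N : ℕ} [NeZero N]

theorem isProbabilityMeasure_uniformFin :
    @IsProbabilityMeasure (Fin N) ⊤ (uniformFin N) :=
  letI : MeasurableSpace (Fin N) := ⊤
  PMF.toMeasure.isProbabilityMeasure _

theorem uniformFin_real (s : Set (Fin N)) :
    (uniformFin N).real s = (Nat.card s : ℝ) / N := by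
  classical
  let : MeasurableSpace (Fin N) := ⊤
  rw [uniformFin, Measure.real, PMF.toMeasure_uniformOfFintype_apply _ (by trivial)]
  simp [Nat.card_eq_fintype_card]

theorem isRandomVariable_top {Ω S : Type*} (Z : Ω → S) : @IsRandomVariable Ω ⊤ S Z :=
  fun _ => trivial

end UniformSpace

section Zero

variable {Ω : Type*} [MeasurableSpace Ω] {P : Measure Ω} [IsProbabilityMeasure P]
  {S T : Type*} [Fintype S] [Fintype T]

theorem condEntropy_eq_zero_of_factor {Z : Ω → S} {Y : Ω → T} (q : ℕ) (hY : IsRandomVariable Y)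
    (h : ∀ ω ω', Y ω = Y ω' → Z ω = Z ω') : condEntropy q P Z Y = 0 := by
  obtain ⟨ω₀⟩ := P.nonempty_of_neZero
  have : Nonempty S := ⟨Z ω₀⟩
  obtain ⟨φ, hφ⟩ := (Function.factorsThrough_iff (f := Y) Z).1 fun ω ω' => h ω ω'
  subst hφ
  rw [condEntropy]
  rw [show (fun ω => ((φ ∘ Y) ω, Y ω)) = fun ω => (fun y => (φ y, y)) (Y ω) from rfl,
    entropy_comp hY q fun y => (φ y, y), show entropy q P Y = entropy q P fun ω => id (Y ω) from rfl,
    entropy_comp hY, fEntropy_congr (fun _ => measureReal_nonneg)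
      (f := fun y => (φ y, y)) (g := id), sub_self]
  simp +contextual

theorem mutualInfo_eq_zero_of_indep {Z : Ω → S} {Y : Ω → T} (q : ℕ) (hZ : IsRandomVariable Z)
    (hY : IsRandomVariable Y) (h : ∀ z y, P.real ((fun ω => (Z ω, Y ω)) ⁻¹' {(z, y)}) =
      P.real (Z ⁻¹' {z}) * P.real (Y ⁻¹' {y})) : mutualInfo q P Z Y = 0 := by
  rw [mutualInfo, sub_eq_zero, entropy, entropy, entropy, ← Finset.sum_div, ← Finset.sum_div,
    ← Finset.sum_div, ← add_div, Fintype.sum_prod_type]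
  congr 1
  simp only [h, Real.negMulLog_mul, Finset.sum_add_distrib, ← Finset.sum_mul, ← Finset.mul_sum,
    sum_measureReal_preimage hZ, sum_measureReal_preimage hY, one_mul]

end Zero

section Build

variable {F : Type*} [Field F] [Fintype F] {k n f μ : ℕ} {G : Matrix (Fin k) (Fin n) F}
  {V : Matrix (Fin μ) (Fin f) F}

/-- A protocol from a randomized linear scheme with uniform randomness `𝒢`, query functions `qry` and
answer functions `ans`. -/
theorem exists_protocol {β : ℕ} (hβ : 0 < β) {𝒬 𝒢 : Type*} {𝒜 : Fin n → Type*} [Finite 𝒬] [Finite 𝒢]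
    [Nonempty 𝒢] [∀ j, Finite (𝒜 j)] (qry : Fin μ → Fin n → 𝒢 → 𝒬)
    (ans : ∀ j, 𝒬 → (Fin f → Fin β → F) → 𝒜 j)
    (hpriv : ∀ v v' j, ∃ σ : Equiv.Perm 𝒢, ∀ g, qry v j (σ g) = qry v' j g)
    (hrec : ∀ v g (w w' : Messages F f β k),
      (∀ j, ans j (qry v j g) (stored G w j) = ans j (qry v j g) (stored G w' j)) →
        evaluation V w v = evaluation V w' v) :
    ∃ p : PLCProtocol G V, p.β = β ∧ ∀ j, Fintype.card (p.Answer j) = Nat.card (𝒜 j) := by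
  classical
  -- `PLCProtocol` wants alphabets and sample space in `Type`, while `F` may live in any universe;
  -- hence all are relabelled by some `Fin N`.
  have eQ := Finite.equivFin 𝒬
  have eA := fun j => Finite.equivFin (𝒜 j)
  have eΩ := Finite.equivFin (Messages F f β k × 𝒢)
  set N := Nat.card (Messages F f β k × 𝒢) with hN
  have : NeZero N := ⟨Nat.card_pos.ne'⟩
  let : MeasurableSpace (Fin N) := ⊤
  have hPr := isProbabilityMeasure_uniformFin (N := N)
  have hreal : ∀ s : Set (Messages F f β k × 𝒢),
      (uniformFin N).real (eΩ.symm ⁻¹' s) = (Nat.card s : ℝ) / N := fun s => by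
    rw [uniformFin_real]
    congr 2
    exact Nat.card_congr (eΩ.symm.subtypeEquiv fun _ => Iff.rfl)
  have hN' : (N : ℝ) = Fintype.card (Messages F f β k) * Nat.card 𝒢 := by
    rw [hN, Nat.card_prod, Nat.cast_mul, Nat.card_eq_fintype_card]
  have hG0 : (Nat.card 𝒢 : ℝ) ≠ 0 := by exact_mod_cast Nat.card_pos.ne'
  have hM0 : (Fintype.card (Messages F f β k) : ℝ) ≠ 0 := by
    exact_mod_cast Fintype.card_ne_zero
  have hprod : ∀ (s : Set (Messages F f β k)) (t : Set 𝒢),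
      (uniformFin N).real (eΩ.symm ⁻¹' s ×ˢ t) =
        (s.ncard : ℝ) / Fintype.card (Messages F f β k) * ((t.ncard : ℝ) / Nat.card 𝒢) := by
    intro s t
    rw [hreal, Nat.card_coe_set_eq, Set.ncard_prod, Nat.cast_mul, hN', mul_div_mul_comm]
  have hunif : ∀ w : Messages F f β k,
      (uniformFin N).real ((fun ω => (eΩ.symm ω).1) ⁻¹' {w}) =
        1 / (Fintype.card (Messages F f β k) : ℝ) := by
    intro w
    have h1 := hprod {w} Set.univ
    rw [Set.ncard_singleton, Set.ncard_univ, div_self hG0, mul_one, Nat.cast_one] at h1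
    rw [← h1]
    congr 1
    ext ω
    simp
  refine ⟨{
    β := β
    β_pos := hβ
    Ω := Fin N
    measurableSpace := ⊤
    P := uniformFin N
    isProbabilityMeasure := hPr
    Query := Fin (Nat.card 𝒬)
    fintypeQuery := inferInstance
    Answer := fun j => Fin (Nat.card (𝒜 j))
    fintypeAnswer := fun j => inferInstance
    W := fun ω => (eΩ.symm ω).1
    Q := fun v j ω => eQ (qry v j (eΩ.symm ω).2)
    A := fun v j ω => eA j (ans j (qry v j (eΩ.symm ω).2) (stored G (eΩ.symm ω).1 j))
    isRandomVariable_W := isRandomVariable_top _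
    isRandomVariable_Q := fun v j => isRandomVariable_top _
    isRandomVariable_A := fun v j => isRandomVariable_top _
    uniform := hunif
    independence := ?_
    deterministic := ?_
    privacy := ?_
    recovery := ?_ }, rfl, fun j => Fintype.card_fin _⟩
  · intro v
    refine mutualInfo_eq_zero_of_indep _ (isRandomVariable_top _) (isRandomVariable_top _) ?_
    intro w y
    rw [hunif]
    have e1 : (fun ω => ((eΩ.symm ω).1, fun j => eQ (qry v j (eΩ.symm ω).2))) ⁻¹' {(w, y)} =
        eΩ.symm ⁻¹' (({w} : Set (Messages F f β k)) ×ˢ {g | (fun j => eQ (qry v j g)) = y}) := by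
      ext ω
      simp [Prod.ext_iff]
    have e2 : (fun ω => fun j => eQ (qry v j (eΩ.symm ω).2)) ⁻¹' {y} =
        eΩ.symm ⁻¹' ((Set.univ : Set (Messages F f β k)) ×ˢ
          {g | (fun j => eQ (qry v j g)) = y}) := by
      ext ω
      simp
    rw [e1, e2, hprod, hprod, Set.ncard_singleton, Set.ncard_univ,
      Nat.card_eq_fintype_card (α := Messages F f β k),
      div_self hM0, one_mul, Nat.cast_one]
  · intro v j
    refine condEntropy_eq_zero_of_factor _ (isRandomVariable_top _) fun ω ω' h => ?_
    simp only [Prod.mk.injEq, EmbeddingLike.apply_eq_iff_eq] at h ⊢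
    rw [h.1, h.2]
  · intro v v' j _ z
    obtain ⟨σ, hσ⟩ := hpriv v v' j
    let Θ : 𝒬 × Messages F f β k → Fin (Nat.card 𝒬) × Fin (Nat.card (𝒜 j)) ×
      (Fin μ → Fin β × Fin k → F) := fun x =>
        (eQ x.1, eA j (ans j x.1 (stored G x.2 j)), evaluation V x.2)
    have h1 := hreal {x | Θ (qry v j x.2, x.1) = z}
    have h2 := hreal {x | Θ (qry v' j x.2, x.1) = z}
    refine h1.trans (Eq.trans ?_ h2.symm)
    congr 2
    refine (Nat.card_congr (((Equiv.refl _).prodCongr σ).subtypeEquiv fun x => ?_)).symm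
    simp [hσ]
  · intro v
    refine condEntropy_eq_zero_of_factor _ (isRandomVariable_top _) fun ω ω' h => ?_
    simp only [Prod.mk.injEq, funext_iff, EmbeddingLike.apply_eq_iff_eq] at h
    refine hrec v (eΩ.symm ω).2 _ _ fun j => ?_
    rw [h.1 j, ← h.2 j]

end Build

/-! ### Achievability -/

section Achievability

theorem finite_linearEquiv (F M N : Type*) [Field F] [AddCommGroup M] [AddCommGroup N] [Module F M]
    [Module F N] [Finite M] [Finite N] : Finite (M ≃ₗ[F] N) :=
  Finite.of_injective (fun g : M ≃ₗ[F] N => (g : M → N)) DFunLike.coe_injective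

variable {F : Type*} [Field F] {k n f μ : ℕ} {G : Matrix (Fin k) (Fin n) F}
  {V : Matrix (Fin μ) (Fin f) F}

/-- The linear form on the column space of `V` that evaluates the candidate function `v`. -/
def candidateForm (V : Matrix (Fin μ) (Fin f) F) (v : Fin μ) :
    Module.Dual F (LinearMap.range V.mulVecLin) :=
  (LinearMap.proj v).comp (Submodule.subtype _)

theorem exists_candidateForm_eq_one {v : Fin μ} (hv : V v ≠ 0) : ∃ e, candidateForm V v e = 1 := by
  obtain ⟨m, hm⟩ := Function.ne_iff.1 hv
  refine ⟨(V v m)⁻¹ • V.mulVecLin.rangeRestrict (Pi.single m 1), ?_⟩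
  have : candidateForm V v (V.mulVecLin.rangeRestrict (Pi.single m 1)) = V v m := by
    simp [candidateForm]
  rw [map_smul, this]
  exact inv_mul_cancel₀ hm

/-- The vector of all candidate functions applied to each of the rows that a database stores. -/
def candidateVector (V : Matrix (Fin μ) (Fin f) F) {β : ℕ} (c : Fin f → Fin β → F) (i : Fin β) :
    LinearMap.range V.mulVecLin :=
  V.mulVecLin.rangeRestrict fun m => c m i

theorem candidateVector_stored {β : ℕ} (w : Messages F f β k) (j : Fin n) (i : Fin β) :
    candidateVector V (stored G w j) i =
      ∑ a, G a j • V.mulVecLin.rangeRestrict fun m => w m i a := by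
  simp only [candidateVector, ← map_smul, ← map_sum]
  congr 1
  funext m
  simp [stored_apply, mul_comm]

theorem finrank_symbolSpace {ν r : ℕ} {I : Fin ν → Finset (Fin n)} (A : QueryPattern I (r + 1))
    {R : Type*} [AddCommGroup R] [Module F R] [Module.Finite F R] {ε : Module.Dual F R} {e : R}
    (he : ε e = 1) (hr : Module.finrank F R = r + 1) :
    Module.finrank F (SymbolSpace A ε) = ν * ∑ s, r.choose (A.degSymbol s) := by
  rw [Module.finrank_pi_fintype, Fintype.sum_prod_type]
  simp [finrank_kerPower he hr]

theorem finrank_querySpace {ν r : ℕ} {I : Fin ν → Finset (Fin n)} (A : QueryPattern I r)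
    {R : Type*} [AddCommGroup R] [Module F R] [Module.Finite F R] (hr : Module.finrank F R = r) :
    Module.finrank F (QuerySpace A F R) = ∑ m, r.choose (A.degQuery m) := by
  rw [Module.finrank_pi_fintype]
  simp only [exteriorPower.finrank_eq, hr]

theorem finrank_answerSpace {ν r : ℕ} {I : Fin ν → Finset (Fin n)} (A : QueryPattern I r)
    {R : Type*} [AddCommGroup R] [Module F R] [Module.Finite F R] (hr : Module.finrank F R = r) :
    Module.finrank F (AnswerSpace A F R) = ∑ m, r.choose (A.degQuery m + 1) := by
  rw [Module.finrank_pi_fintype]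
  simp only [exteriorPower.finrank_eq, hr]

variable [Fintype F]

/-- The two dimension hypotheses turn `F^β`, the symbol space and the query space into isomorphic
spaces. A query is then an isomorphism `F^β ≃ QuerySpace`, of a type that does not mention the
desired index. -/
theorem exists_protocol_of_queryPattern {ν r β : ℕ} {I : Fin ν → Finset (Fin n)}
    (hI : ∀ u, IsInformationSet G (I u)) (A : QueryPattern I (r + 1)) (hr : V.rank = r + 1)
    (hV : ∀ v, V v ≠ 0) (hβ : 0 < β) (hsymbol : ν * ∑ s, r.choose (A.degSymbol s) = β)
    (hquery : ∑ m, (r + 1).choose (A.degQuery m) = β) :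
    ∃ p : PLCProtocol G V, p.β = β ∧ p.downloadLength =
      n * (∑ m, (r + 1).choose (A.degQuery m + 1) : ℕ) := by
  set R := LinearMap.range V.mulVecLin with hR
  have hrank : Module.finrank F R = r + 1 := hr
  choose e he using fun v => exists_candidateForm_eq_one (hV v)
  have hdim : ∀ v, Module.finrank F (SymbolSpace A (candidateForm V v)) = β := fun v => by
    rw [finrank_symbolSpace A (he v) hrank, hsymbol]
  have hdim' : Module.finrank F (QuerySpace A F R) = β := by
    rw [finrank_querySpace A hrank, hquery]
  let c : ∀ v, (Fin β → F) ≃ₗ[F] SymbolSpace A (candidateForm V v) := fun v =>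
    LinearEquiv.ofFinrankEq _ _ (by rw [hdim, Module.finrank_fin_fun])
  let Θ : Fin μ → Fin n → (Fin β → F) ≃ₗ[F] QuerySpace A F R := fun v j =>
    (c v).trans (maskedQueryEquiv A (he v) hrank (by rw [hdim, hdim']) j)
  have : Finite ((Fin β → F) ≃ₗ[F] (Fin β → F)) := finite_linearEquiv _ _ _
  have : Finite (QuerySpace A F R) := Module.finite_of_finite F
  have : Finite (AnswerSpace A F R) := Module.finite_of_finite F
  have : Finite ((Fin β → F) ≃ₗ[F] QuerySpace A F R) := finite_linearEquiv _ _ _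
  have key := exists_protocol (G := G) (V := V) hβ
    (𝒬 := (Fin β → F) ≃ₗ[F] QuerySpace A F R) (𝒢 := (Fin β → F) ≃ₗ[F] (Fin β → F))
    (𝒜 := fun _ => AnswerSpace A F R) (fun v j g => g.trans (Θ v j))
    (fun _ p y => answer A p (candidateVector V y)) ?_ ?_
  · obtain ⟨p, hpβ, hp⟩ := key
    refine ⟨p, hpβ, ?_⟩
    rw [PLCProtocol.downloadLength]
    have h : ∀ j, Real.log (Fintype.card (p.Answer j)) / Real.log (Fintype.card F) =
        (∑ m, (r + 1).choose (A.degQuery m + 1) : ℕ) := fun j => by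
      rw [hp, Module.natCard_eq_pow_finrank (K := F), finrank_answerSpace A hrank,
        Nat.card_eq_fintype_card, Nat.cast_pow, Real.log_pow,
        mul_div_cancel_right₀ _ log_card_pos.ne']
    rw [Finset.sum_congr rfl fun j _ => h j, Finset.sum_const, Finset.card_univ, Fintype.card_fin,
      nsmul_eq_mul]
  · intro v v' j
    -- Composition with `φ` permutes the uniform randomness and turns the queries for `v` into those
    -- for `v'`.
    let φ := (Θ v' j).trans (Θ v j).symm
    refine ⟨⟨fun g => g.trans φ, fun g => g.trans φ.symm, fun g => ?_, fun g => ?_⟩, fun g => ?_⟩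
    · ext1 x; simp
    · ext1 x; simp
    · ext1 x; simp [φ]
  · intro v g w w' h
    funext ⟨i, a⟩
    rw [← sub_eq_zero]
    have hX := recover_of_answer_eq_zero A hI (he v) (g.trans (c v)).toLinearMap
      (g.trans (c v)).injective
      (fun i a => V.mulVecLin.rangeRestrict (fun m => w m i a) -
        V.mulVecLin.rangeRestrict (fun m => w' m i a)) (fun j => ?_) i a
    · rw [map_sub] at hX
      exact hX
    · have h0 := sub_eq_zero.2 (h j)
      rw [← answer_sub] at h0
      have e1 : candidateVector V (stored G w j) - candidateVector V (stored G w' j) =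
          fun i => ∑ a, G a j • (V.mulVecLin.rangeRestrict (fun m => w m i a) -
            V.mulVecLin.rangeRestrict (fun m => w' m i a)) := by
        funext i
        simp only [Pi.sub_apply, candidateVector_stored, smul_sub, Finset.sum_sub_distrib]
      rw [e1] at h0
      exact h0

end Achievability

/-- A protocol whose number of downloaded symbols meets the lower bound. -/
theorem exists_protocol_downloadLength_eq {F : Type*} [Field F] [Fintype F] {k n f μ : ℕ}
    (hk : 0 < k) (hkn : k < n) (hμ : 0 < μ) {G : Matrix (Fin k) (Fin n) F}
    {V : Matrix (Fin μ) (Fin f) F} (hV : ∀ v : Fin μ, V v ≠ 0) {κ ν : ℕ}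
    {I : Fin ν → Finset (Fin n)} (hν : 0 < ν) (hκν : κ * n = k * ν)
    (hI : ∀ u, IsInformationSet G (I u))
    (hκ : ∀ j, (Finset.univ.filter fun u => j ∈ I u).card = κ) :
    ∃ p : PLCProtocol G V, p.downloadLength =
      ((p.β * k : ℕ) : ℝ) * ∑ t ∈ Finset.range V.rank, ((k : ℝ) / n) ^ t := by
  have hκ0 : 0 < κ := Nat.pos_of_mul_pos_right (hκν ▸ Nat.mul_pos hk hν)
  have hκlt : κ < ν := by
    by_contra! h
    nlinarith [Nat.mul_lt_mul_of_pos_right hkn hν, Nat.mul_le_mul_right n h]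
  obtain ⟨δ, rfl⟩ := Nat.exists_eq_add_of_le hκlt.le
  have hδ : 0 < δ := by omega
  obtain ⟨r, hr⟩ : ∃ r, V.rank = r + 1 := by
    refine Nat.exists_eq_succ_of_ne_zero fun h => ?_
    rw [Matrix.rank_eq_finrank_span_row, Submodule.finrank_eq_zero, Submodule.span_eq_bot] at h
    exact hV ⟨0, hμ⟩ (h _ ⟨_, rfl⟩)
  obtain ⟨A, hA⟩ := exists_queryPattern hκ (r + 1)
  -- This `β` is the common dimension of the symbol space and the query space.
  obtain ⟨p, hpβ, hp⟩ := exists_protocol_of_queryPattern (β := κ * (κ + δ) ^ (r + 1)) hI A hr hV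
    (by positivity)
    (by rw [(hA _).1, sum_pow_mul_choose_pred]; ring)
    (by rw [(hA _).2, sum_pow_mul_choose])
  refine ⟨p, ?_⟩
  rw [hp, hpβ, (hA fun d => (r + 1).choose (d + 1)).2, hr]
  have h1 := sum_pow_mul_choose_succ κ δ (r + 1)
  set D := ∑ d : Fin (r + 1 + 1), κ ^ (r + 1 - d) * δ ^ (d : ℕ) * (r + 1).choose (d + 1)
  have hn0 : (0 : ℝ) < n := by exact_mod_cast hk.trans hkn
  have hν0 : (0 : ℝ) < κ + δ := by exact_mod_cast hν
  have hδ0 : (0 : ℝ) < δ := by exact_mod_cast hδ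
  have hκν' : (κ : ℝ) * n = k * (κ + δ) := by exact_mod_cast hκν
  have hρ : (k : ℝ) / n = κ / (κ + δ) := by
    rw [div_eq_div_iff hn0.ne' hν0.ne', hκν']
  have h1' : (δ : ℝ) * D + κ * κ ^ (r + 1) = κ * (κ + δ) ^ (r + 1) := by exact_mod_cast h1
  have hgeom := mul_neg_geom_sum ((κ : ℝ) / (κ + δ)) (r + 1)
  rw [hρ]
  set σ := ∑ t ∈ Finset.range (r + 1), ((κ : ℝ) / (κ + δ)) ^ t
  rw [div_pow, one_sub_div hν0.ne', add_sub_cancel_left, one_sub_div (pow_pos hν0 _).ne'] at hgeom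
  have h2 : (δ : ℝ) * D = κ * ((κ + δ) ^ (r + 1) - κ ^ (r + 1)) := by linarith
  have h3 : (δ : ℝ) * σ * (κ + δ) ^ (r + 1) =
      (κ + δ) * ((κ + δ) ^ (r + 1) - κ ^ (r + 1)) := by
    field_simp at hgeom
    linarith
  push_cast
  -- The claim `nκD = βkσ` is multiplied by `δ(κ + δ)`, because `h2` and `h3` give `D` and `σ` only
  -- up to the factor `δ`.
  have h4 : (δ : ℝ) * (κ + δ) * (n * (κ * D)) =
      δ * (κ + δ) * (κ * (κ + δ) ^ (r + 1) * k * σ) := by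
    linear_combination (n : ℝ) * κ * (κ + δ) * h2 - κ * k * (κ + δ) * h3 +
      κ * (κ + δ) * ((κ + δ) ^ (r + 1) - κ ^ (r + 1)) * hκν'
  exact mul_left_cancel₀ (mul_pos hδ0 hν0).ne' h4

end PrivateComputation

theorem theorem4 {F : Type*} [Field F] [Fintype F] (n k f μ : ℕ)
    (hk : 0 < k) (hkn : k < n) (hμ : 0 < μ)
    (G : Matrix (Fin k) (Fin n) F) (hG : G.rank = k)
    (hC : PrivateComputation.IsMDSPIRCapacityAchieving G)
    (V : Matrix (Fin μ) (Fin f) F) (hV : ∀ v : Fin μ, V v ≠ 0) :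
    PrivateComputation.IsPLCCapacity G V
      ((1 - (k : ℝ) / n) * (1 - ((k : ℝ) / n) ^ V.rank)⁻¹) := by
  obtain ⟨κ, ν, I, hν, hκν, hI, hκ⟩ := hC.exists_informationSets (hk.trans hkn)
  obtain ⟨p, hp⟩ :=
    PrivateComputation.exists_protocol_downloadLength_eq hk hkn hμ hV hν hκν hI hκ
  exact PrivateComputation.isPLCCapacity_of_exists hk hkn hμ hV hν hκν hI hκ p hp
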